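/- For real $a\in(0,1)$ and $x\in[0,1)$ put $F_a(x)={}_2F_1(a,1-a;1;x)=\sum_{n\ge 0}\frac{(a)_n(1-a)_n}{(n!)^2}x^n$, where $(a)_n=a(a+1)\cdots(a+n-1)$, and for $r\in(0,1)$ put $$\mu_a(r)=\frac{\pi}{2\sin(\pi a)}\frac{F_a(1-r^2)}{F_a(r^2)},\qquad \mu_a^*(r)=\mu_a(r^{3/2})=\frac{\pi}{2\sin(\pi a)}\frac{F_a(1-r^3)}{F_a(r^3)}.$$ For $K>0$ let $\varphi_K(a,r)=\mu_a^{-1}(\mu_a(r)/K)$, where $\mu_a^{-1}$ is the inverse of the decreasing homeomorphism $\mu_a:(0,1)\to(0,\infty)$ ($0<a\le 1/2$), let $\varphi_K^*(a,r)=\varphi_K(a,r^{3/2})^{2/3}$, and write $\varphi_K^*(r)=\varphi_K^*(1/3,r)$. Let $R(a)=-2\gamma-\Psi(a)-\Psi(1-a)$, where $\gamma$ is the Euler–Mascheroni constant and $\Psi=\Gamma'/\Gamma$. **Theorem.** Let $r\in(0,1)$, $r_0=r^*=\sqrt[3]{1-r^3}$ and $$r_n=\frac{\sqrt[3]{9r_{n-1}(1+r_{n-1}+r_{n-1}^2)}}{1+2r_{n-1}}\qquad(n\ge1).$$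 Then $r_n\in(0,1)$ and $r_n=\varphi_{3^n}^*(r^*)$ for all $n\ge0$, and $r_n=\varphi_3^*(r_{n-1})$ for all $n\ge1$. The infinite product $$P=\prod_{n=0}^\infty\left[(1+2r_n)(1+r_n+r_n^2)\right]^{3^{-n}/2}$$ converges, and the following hold. 1. For $a\in(0,1/3]$, $$P\le\exp\left(\mu_a^*(r)+\tfrac32\log r\right)\le\tfrac1{\sqrt{27}}\,e^{R(a)/2}P.$$ 2. For $a\in[1/3,1/2]$, $$\tfrac1{\sqrt{27}}\,e^{R(a)/2}P\le\exp\left(\mu_a^*(r)+\tfrac32\log r\right)\le P.$$ 3. In each of these four inequalities, equality holds if and only if $a=1/3$. 4. In particular, $\exp\left(\mu_{1/3}^*(r)+\tfrac32\log r\right)=\exp\left(\mu_{1/3}(r^{3/2})+\tfrac32\log r\right)=P$, and equivalently $$\mu_{1/3}^*(r)+\tfrac32\log r=\mu_{1/3}(r^{3/2})+\tfrac32\log r=\frac12\sum_{n=0}^\infty 3^{-n}\log\left[(1+2r_n)(1+r_n+r_n^2)\right],$$ where the series converges. -/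

import Mathlib

open Set

namespace CubicModular

noncomputable section

/-- The function `F(a, 1 - a; 1; x)`, where `F` is the Gaussian hypergeometric function. -/
def F (a x : ℝ) : ℝ := ordinaryHypergeometric a (1 - a) (1 : ℝ) x

/-- `μ_a(r) = π / (2 sin (π a)) * F(a,1-a;1;1-r²) / F(a,1-a;1;r²)`. -/
def mu (a r : ℝ) : ℝ :=
  Real.pi / (2 * Real.sin (Real.pi * a)) * (F a (1 - r ^ 2) / F a (r ^ 2))

/-- `μ_a^*(r) = π / (2 sin (π a)) * F(a,1-a;1;1-r³) / F(a,1-a;1;r³)`. -/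
def muStar (a r : ℝ) : ℝ :=
  Real.pi / (2 * Real.sin (Real.pi * a)) * (F a (1 - r ^ 3) / F a (r ^ 3))

/-- `φ_K(a,r) = μ_a⁻¹(μ_a(r) / K)`, the inverse being that of `μ_a` on `(0,1)`. -/
def phi (K a r : ℝ) : ℝ := Function.invFunOn (mu a) (Ioo 0 1) (mu a r / K)

/-- `φ_K^*(a,r) = φ_K(a, r^{3/2})^{2/3}`. -/
def phiStar (K a r : ℝ) : ℝ := phi K a (r ^ (3 / 2 : ℝ)) ^ (2 / 3 : ℝ)

/-- `r^* = (1 - r³)^{1/3}`. -/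
def rStar (r : ℝ) : ℝ := (1 - r ^ 3) ^ (1 / 3 : ℝ)

/-- The sequence `r₀ = r^*`, `r_{n+1} = (9 r_n (1 + r_n + r_n²))^{1/3} / (1 + 2 r_n)`. -/
def rSeq (r : ℝ) : ℕ → ℝ
  | 0 => rStar r
  | n + 1 => (9 * rSeq r n * (1 + rSeq r n + rSeq r n ^ 2)) ^ (1 / 3 : ℝ) / (1 + 2 * rSeq r n)

/-- The factor `[(1 + 2 r_n)(1 + r_n + r_n²)]^{3^{-n}/2}`. -/
def factor (r : ℝ) (n : ℕ) : ℝ :=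
  ((1 + 2 * rSeq r n) * (1 + rSeq r n + rSeq r n ^ 2)) ^ (((3 : ℝ) ^ n)⁻¹ / 2)

/-- The term `3^{-n} log [(1 + 2 r_n)(1 + r_n + r_n²)]`. -/
def logTerm (r : ℝ) (n : ℕ) : ℝ :=
  ((3 : ℝ) ^ n)⁻¹ * Real.log ((1 + 2 * rSeq r n) * (1 + rSeq r n + rSeq r n ^ 2))

/-- The psi function `Ψ = Γ' / Γ` on the positive reals. -/
def psi (x : ℝ) : ℝ := deriv Real.Gamma x / Real.Gamma x

/-- `R(a) = -2γ - Ψ(a) - Ψ(1 - a)`, with `γ` the Euler-Mascheroni constant. -/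
def R (a : ℝ) : ℝ := -2 * Real.eulerMascheroniConstant - psi a - psi (1 - a)

end

end CubicModular

open CubicModular

open Filter Topology

namespace CubicModular

/-! ### The Taylor coefficients of `F a` -/

/-! Put `modulus a x` = μ_a(√x), so that μ_a^*(r) is its value at r³. Two independent facts combine.

For a = 1/3 there is a cubic transformation. With g(x) = 1 - ((1-x)/(1+2x))³, `F_cubicMap` gives
F(g(x)) = (1+2x) F(x³): both sides solve the same second-order equation and are regular at 0 with
value 1. Since x ↦ (1-x)/(1+2x) is an involution, the complementary function transforms too, and
`modulus_cubicMap` says that passing from x³ to g(x) divides the modulus by 3. This identifies r_n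
with the orbit of r^* under φ_3^*. The complements c_n = 1 - r_n³ start at r³, have moduli
multiplied by 3 at each step, and satisfy c_{n+1} = (c_n / b_n)³ with b_n = (1+2r_n)(1+r_n+r_n²).
Hence 3^{-n}(modulus(c_n) + ½ log c_n) drops by ½ 3^{-n} log b_n at each step. The bracket stays
bounded as c_n → 0, so telescoping gives the series and the product.

For general a, the Legendre relation `wronskian_eq` yields d/dx modulus = -1/(2x(1-x)F_a(x)²). As
F_a increases with a on (0,1/2], the difference of two moduli is strictly monotone in x. It tends to
0 at x = 1 and, by `tendsto_modulus_add_log`, to (R(a)-R(b))/2 at x = 0. Taking 1/3 as one of the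
parameters, with R(1/3) = log 27, gives all four inequalities, strict for a ≠ 1/3.

The constant R(a) comes from F_a(1-x) + κ log x → κ R(a), κ = sin(πa)/π. By Abel's theorem the limit
is ∑(coeff - κ/n), which is evaluated by perturbing the third parameter of Gauss's summation
formula. -/

/-- The Taylor coefficients of `F a`. -/
noncomputable def coeff (a : ℝ) (n : ℕ) : ℝ := ordinaryHypergeometricCoefficient a (1 - a) 1 n

lemma coeff_zero (a : ℝ) : coeff a 0 = 1 := by simp [coeff, ordinaryHypergeometricCoefficient]

lemma coeff_succ (a : ℝ) (n : ℕ) :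
    coeff a (n + 1) = coeff a n * ((n + a) * (n + 1 - a) / (n + 1) ^ 2) := by
  have h1 : ((n : ℝ) + 1) ≠ 0 := by positivity
  have h2 : (n.factorial : ℝ) ≠ 0 := by positivity
  simp only [coeff, ordinaryHypergeometricCoefficient, ascPochhammer_succ_eval,
    ascPochhammer_eval_one, Nat.factorial_succ, Nat.cast_mul, Nat.cast_succ]
  field_simp
  ring

lemma F_eq_tsum (a x : ℝ) : F a x = ∑' n, coeff a n * x ^ n := by
  simp only [F, ordinaryHypergeometric_eq_tsum, coeff, ordinaryHypergeometricCoefficient, smul_eq_mul]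

lemma coeff_one (a : ℝ) : coeff a 1 = a * (1 - a) := by
  have := coeff_succ a 0
  simpa [coeff_zero] using this

lemma coeff_pos {a : ℝ} (ha : a ∈ Ioo (0 : ℝ) 1) (n : ℕ) : 0 < coeff a n := by
  obtain ⟨h0, h1⟩ := ha
  induction n with
  | zero => simp [coeff_zero]
  | succ n ih =>
    rw [coeff_succ]
    have : (0 : ℝ) ≤ n := n.cast_nonneg
    have h2 : 0 < (n : ℝ) + 1 - a := by linarith
    positivity

lemma coeff_le_one {a : ℝ} (ha : a ∈ Ioo (0 : ℝ) 1) (n : ℕ) : coeff a n ≤ 1 := by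
  induction n with
  | zero => simp [coeff_zero]
  | succ n ih =>
    rw [coeff_succ]
    have : (0 : ℝ) ≤ n := n.cast_nonneg
    refine mul_le_one₀ ih ?_ ?_
    · have h2 : 0 < (n : ℝ) + 1 - a := by linarith [ha.2]
      have := ha.1
      positivity
    · rw [div_le_one (by positivity)]
      nlinarith [ha.1, ha.2, sq_nonneg (a - 1 / 2)]

/-- The recursion for `n * coeff a n`, in difference form. -/
lemma succ_mul_coeff_sub (a : ℝ) (n : ℕ) :
    (n + 1) * coeff a (n + 1) - n * coeff a n = a * (1 - a) * coeff a n / (n + 1) := by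
  have h1 : ((n : ℝ) + 1) ≠ 0 := by positivity
  rw [coeff_succ]
  field_simp
  ring

lemma coeff_eq_prod (a : ℝ) (n : ℕ) :
    coeff a n = (∏ j ∈ Finset.range n, (a + j)) * (∏ j ∈ Finset.range n, (1 - a + j)) /
      (n.factorial : ℝ) ^ 2 := by
  induction n with
  | zero => simp [coeff_zero]
  | succ n ih =>
    have h1 : ((n : ℝ) + 1) ≠ 0 := by positivity
    have h2 : (n.factorial : ℝ) ≠ 0 := by positivity
    rw [coeff_succ, ih, Finset.prod_range_succ, Finset.prod_range_succ, Nat.factorial_succ]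
    push_cast
    field_simp
    ring

/-- The constant `sin (π a) / π`, which is `1 / (Γ a * Γ (1 - a))`. -/
noncomputable def kappa (a : ℝ) : ℝ := Real.sin (Real.pi * a) / Real.pi

lemma kappa_pos {a : ℝ} (ha : a ∈ Ioo (0 : ℝ) 1) : 0 < kappa a := by
  have := Real.pi_pos
  refine div_pos (Real.sin_pos_of_pos_of_lt_pi (mul_pos this ha.1) ?_) this
  nlinarith [ha.2]

lemma Gamma_mul_Gamma_one_sub_eq_inv_kappa (a : ℝ) :
    Real.Gamma a * Real.Gamma (1 - a) = (kappa a)⁻¹ := by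
  rw [Real.Gamma_mul_Gamma_one_sub, kappa, inv_div]

/-- Euler's limit for Γ(a)Γ(1-a), inverted: the two products in `coeff_eq_prod` are the denominators
of the Euler sequences, and the reflection formula supplies the value. -/
lemma tendsto_mul_coeff {a : ℝ} (ha : a ∈ Ioo (0 : ℝ) 1) :
    Tendsto (fun n : ℕ => (n : ℝ) * coeff a n) atTop (𝓝 (kappa a)) := by
  rw [← tendsto_add_atTop_iff_nat 1]
  have h1 := ((Real.GammaSeq_tendsto_Gamma a).mul (Real.GammaSeq_tendsto_Gamma (1 - a))).inv₀
    (by rw [Gamma_mul_Gamma_one_sub_eq_inv_kappa]; exact inv_ne_zero (kappa_pos ha).ne')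
  rw [Gamma_mul_Gamma_one_sub_eq_inv_kappa, inv_inv] at h1
  have h2 := (tendsto_natCast_div_add_atTop (1 : ℝ)).mul h1
  rw [one_mul] at h2
  refine h2.congr' ?_
  filter_upwards [eventually_gt_atTop 0] with n hn
  have hn' : (0 : ℝ) < n := by exact_mod_cast hn
  have e : (n : ℝ) ^ a * (n : ℝ) ^ (1 - a) = n := by
    rw [← Real.rpow_add hn']; simp
  rw [coeff_eq_prod, Real.GammaSeq, Real.GammaSeq, Nat.factorial_succ]
  have p1 : ∏ j ∈ Finset.range (n + 1), (a + j) ≠ 0 :=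
    Finset.prod_ne_zero_iff.2 fun j _ => by have := ha.1; positivity
  have p2 : ∏ j ∈ Finset.range (n + 1), (1 - a + j) ≠ 0 :=
    Finset.prod_ne_zero_iff.2 fun j _ => by have := sub_pos.2 ha.2; positivity
  have h3 : (n.factorial : ℝ) ≠ 0 := by positivity
  have h4 : (n : ℝ) ^ a ≠ 0 := by positivity
  have h5 : (n : ℝ) ^ (1 - a) ≠ 0 := by positivity
  push_cast
  field_simp
  rw [e]

lemma mul_coeff_le_kappa {a : ℝ} (ha : a ∈ Ioo (0 : ℝ) 1) (n : ℕ) : n * coeff a n ≤ kappa a := by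
  refine (monotone_nat_of_le_succ (f := fun n : ℕ => (n : ℝ) * coeff a n) fun n => ?_).ge_of_tendsto
    (tendsto_mul_coeff ha) n
  have := succ_mul_coeff_sub a n
  have h : 0 ≤ a * (1 - a) * coeff a n / (n + 1) := by
    have := coeff_pos ha n
    have := ha.1
    have := sub_pos.2 ha.2
    positivity
  push_cast
  linarith

/-- Whereas n · coeff n increases to κ, (n+1) · coeff n decreases to it for n ≥ 1. The two bounds
trap coeff n between κ/(n+1) and κ/n. -/
lemma kappa_le_succ_mul_coeff {a : ℝ} (ha : a ∈ Ioo (0 : ℝ) 1) (n : ℕ) :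
    kappa a ≤ (n + 2) * coeff a (n + 1) := by
  have hl : Tendsto (fun n : ℕ => ((n : ℝ) + 2) * coeff a (n + 1)) atTop (𝓝 (kappa a)) := by
    have h1 := (tendsto_add_atTop_iff_nat 1).2 (tendsto_mul_coeff ha)
    have h2 : Tendsto (fun n : ℕ => ((n : ℝ) + 1 + 1) / ((n + 1 : ℕ) : ℝ)) atTop (𝓝 1) := by
      have := ((tendsto_const_nhds (x := (1 : ℝ))).add
        (tendsto_one_div_add_atTop_nhds_zero_nat (𝕜 := ℝ)))
      rw [add_zero] at this
      refine this.congr fun n => ?_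
      have : ((n : ℝ) + 1) ≠ 0 := by positivity
      push_cast
      field_simp
    have h3 := h2.mul h1
    rw [one_mul] at h3
    refine h3.congr fun n => ?_
    have : ((n : ℝ) + 1) ≠ 0 := by positivity
    push_cast
    field_simp
    ring
  refine (antitone_nat_of_succ_le (f := fun n : ℕ => ((n : ℝ) + 2) * coeff a (n + 1))
    fun n => ?_).le_of_tendsto hl n
  have hc := coeff_pos ha (n + 1)
  have hn : (0 : ℝ) ≤ n := n.cast_nonneg
  have key : ((n + 1 : ℕ) + a) * ((n + 1 : ℕ) + 1 - a) / ((n + 1 : ℕ) + 1 : ℝ) ^ 2 *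
      ((n + 1 : ℕ) + 2) ≤ (n : ℝ) + 2 := by
    push_cast
    rw [div_mul_eq_mul_div, div_le_iff₀ (by positivity)]
    nlinarith [ha.1, ha.2, sq_nonneg (a - 1 / 2), mul_nonneg hn (sq_nonneg (a - 1 / 2))]
  calc _ = coeff a (n + 1) * (((n + 1 : ℕ) + a) * ((n + 1 : ℕ) + 1 - a) /
        ((n + 1 : ℕ) + 1 : ℝ) ^ 2 * ((n + 1 : ℕ) + 2)) := by rw [coeff_succ a (n + 1)]; ring
    _ ≤ coeff a (n + 1) * (n + 2) := mul_le_mul_of_nonneg_left key hc.le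
    _ = _ := mul_comm _ _

/-- The difference `coeff a n - kappa a / n` is `O(1 / n ^ 2)`. -/
lemma abs_coeff_sub_le {a : ℝ} (ha : a ∈ Ioo (0 : ℝ) 1) (n : ℕ) :
    |coeff a (n + 1) - kappa a / (n + 1)| ≤ kappa a * (1 / ((n + 1 : ℕ) : ℝ) ^ 2) := by
  have h1 := mul_coeff_le_kappa ha (n + 1)
  have h2 := kappa_le_succ_mul_coeff ha n
  have h3 := kappa_pos ha
  have hn : (0 : ℝ) < n + 1 := by positivity
  push_cast at h1 ⊢
  have h4 : coeff a (n + 1) ≤ kappa a / (n + 1) := by rw [le_div_iff₀ hn]; linarith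
  rw [abs_of_nonpos (by linarith), neg_sub, sub_le_iff_le_add]
  have h5 : kappa a / (n + 1) = kappa a / (n + 1) ^ 2 * (n + 1) := by field_simp
  have h6 : kappa a / (n + 1) ≤ coeff a (n + 1) + coeff a (n + 1) / (n + 1) := by
    rw [div_le_iff₀ hn, add_mul, div_mul_cancel₀ _ hn.ne']
    linarith
  have h7 : coeff a (n + 1) / (n + 1) ≤ kappa a * (1 / (n + 1) ^ 2) := by
    rw [div_le_iff₀ hn]
    calc _ ≤ kappa a / (n + 1) := h4
      _ = _ := by field_simp
  linarith

lemma summable_coeff_sub (a : ℝ) :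
    Summable fun n : ℕ => kappa a * (1 / ((n + 1 : ℕ) : ℝ) ^ 2) :=
  ((summable_nat_add_iff 1).2 (Real.summable_one_div_nat_pow.2 one_lt_two)).mul_left _

/-! ### Power series with bounded coefficients -/

lemma summable_mul_pow_of_bounded {u : ℕ → ℝ} {M x : ℝ} (hu : ∀ n, |u n| ≤ M) (hx : |x| < 1) :
    Summable fun n => u n * x ^ n := by
  refine Summable.of_norm_bounded ((summable_geometric_of_lt_one (abs_nonneg x) hx).mul_left M)
    fun n => ?_
  rw [norm_mul, norm_pow, Real.norm_eq_abs, Real.norm_eq_abs]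
  exact mul_le_mul_of_nonneg_right (hu n) (by positivity)

lemma hasDerivAt_tsum_mul_pow {u : ℕ → ℝ} {M x : ℝ} (hu : ∀ n, |u n| ≤ M) (hx : |x| < 1) :
    HasDerivAt (fun y => ∑' n, u n * y ^ n) (∑' n, (n + 1) * u (n + 1) * x ^ n) x := by
  -- On the ball of radius ρ the differentiated terms are dominated by M n ρ^(n-1), which is
  -- summable.
  obtain ⟨ρ, hρ, hρ1⟩ := exists_between hx
  have hρ0 : 0 < ρ := (abs_nonneg x).trans_lt hρ
  have hM : 0 ≤ M := (abs_nonneg _).trans (hu 0)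
  have hs : Summable fun n : ℕ => M * (n * ρ ^ (n - 1)) := by
    refine Summable.mul_left _ ?_
    rw [← summable_nat_add_iff 1]
    have h := summable_pow_mul_geometric_of_norm_lt_one 1 (r := ρ)
      (by rwa [Real.norm_of_nonneg hρ0.le])
    have h' := summable_geometric_of_lt_one hρ0.le hρ1
    refine (h.add h').congr fun n => ?_
    simp
    ring
  have key := hasDerivAt_tsum_of_isPreconnected (g := fun n y => u n * y ^ n)
    (g' := fun n y => u n * (n * y ^ (n - 1))) (y := x) (y₀ := x) hs
    (Metric.isOpen_ball (x := (0 : ℝ)) (ε := ρ)) (convex_ball (0 : ℝ) ρ).isPreconnected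
    (fun n y _ => (hasDerivAt_pow n y).const_mul (u n))
    (fun n y hy => by
      rw [mem_ball_zero_iff, Real.norm_eq_abs] at hy
      rw [norm_mul, norm_mul, norm_pow, Real.norm_natCast, Real.norm_eq_abs, Real.norm_eq_abs]
      gcongr
      exact hu n)
    (by simpa using hρ) (summable_mul_pow_of_bounded hu hx) (by simpa using hρ)
  refine key.congr_deriv ?_
  have hsum : Summable fun n : ℕ => u n * (n * x ^ (n - 1)) := by
    refine Summable.of_norm_bounded hs fun n => ?_
    rw [norm_mul, norm_mul, norm_pow, Real.norm_natCast, Real.norm_eq_abs, Real.norm_eq_abs]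
    gcongr
    exact hu n
  rw [hsum.tsum_eq_zero_add]
  simp only [CharP.cast_eq_zero, zero_mul, mul_zero, zero_add, Nat.cast_add, Nat.cast_one,
    Nat.add_sub_cancel]
  exact tsum_congr fun n => by ring

/-! ### The function `F a` and its differential equation -/

lemma abs_coeff_le_one {a : ℝ} (ha : a ∈ Ioo (0 : ℝ) 1) (n : ℕ) : |coeff a n| ≤ 1 := by
  rw [abs_of_pos (coeff_pos ha n)]
  exact coeff_le_one ha n

lemma summable_coeff_mul_pow {a x : ℝ} (ha : a ∈ Ioo (0 : ℝ) 1) (hx : |x| < 1) :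
    Summable fun n => coeff a n * x ^ n :=
  summable_mul_pow_of_bounded (abs_coeff_le_one ha) hx

lemma F_zero (a : ℝ) : F a 0 = 1 := by
  rw [F, ordinaryHypergeometric_zero]

lemma one_le_F {a x : ℝ} (ha : a ∈ Ioo (0 : ℝ) 1) (hx : x ∈ Ico (0 : ℝ) 1) : 1 ≤ F a x := by
  have h := summable_coeff_mul_pow ha (x := x) (by rw [abs_of_nonneg hx.1]; exact hx.2)
  rw [F_eq_tsum, h.tsum_eq_zero_add, coeff_zero]
  have : 0 ≤ ∑' n, coeff a (n + 1) * x ^ (n + 1) :=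
    tsum_nonneg fun n => mul_nonneg (coeff_pos ha _).le (pow_nonneg hx.1 _)
  simpa using this

lemma F_pos {a x : ℝ} (ha : a ∈ Ioo (0 : ℝ) 1) (hx : x ∈ Ico (0 : ℝ) 1) : 0 < F a x :=
  one_pos.trans_le (one_le_F ha hx)

/-- The derivative of `F a`. -/
noncomputable def dF (a x : ℝ) : ℝ := ∑' n : ℕ, (n + 1) * coeff a (n + 1) * x ^ n

lemma hasDerivAt_F {a x : ℝ} (ha : a ∈ Ioo (0 : ℝ) 1) (hx : |x| < 1) :
    HasDerivAt (F a) (dF a x) x := by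
  have h := hasDerivAt_tsum_mul_pow (abs_coeff_le_one ha) hx
  rwa [← funext (F_eq_tsum a)] at h

lemma abs_succ_mul_coeff_le {a : ℝ} (ha : a ∈ Ioo (0 : ℝ) 1) (n : ℕ) :
    |(n + 1) * coeff a (n + 1)| ≤ kappa a := by
  have h := mul_coeff_le_kappa ha (n + 1)
  have := coeff_pos ha (n + 1)
  push_cast at h
  rwa [abs_of_nonneg (by positivity)]

/-- The quantity `x (1 - x) F'(x)`, whose derivative is `a (1 - a) F(x)`. -/
noncomputable def flux (a x : ℝ) : ℝ := x * (1 - x) * dF a x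

/-- The Taylor coefficients of `flux a`. -/
noncomputable def fluxCoeff (a : ℝ) : ℕ → ℝ
  | 0 => 0
  | n + 1 => (n + 1) * coeff a (n + 1) - n * coeff a n

lemma fluxCoeff_zero (a : ℝ) : fluxCoeff a 0 = 0 := rfl

lemma fluxCoeff_succ_eq (a : ℝ) (n : ℕ) :
    fluxCoeff a (n + 1) = (n + 1) * coeff a (n + 1) - n * coeff a n := rfl

/-- The series of x F' has coefficients n · coeff n; multiplying by 1 - x takes their differences.
-/
lemma flux_eq_tsum {a x : ℝ} (ha : a ∈ Ioo (0 : ℝ) 1) (hx : |x| < 1) :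
    flux a x = ∑' n, fluxCoeff a n * x ^ n := by
  have hb : ∀ n : ℕ, |(n : ℝ) * coeff a n| ≤ kappa a := fun n => by
    have := coeff_pos ha n
    rw [abs_of_nonneg (by positivity)]
    exact mul_coeff_le_kappa ha n
  have h1 := summable_mul_pow_of_bounded (abs_succ_mul_coeff_le ha) hx
  have h2 := summable_mul_pow_of_bounded hb hx
  have h3 : x * dF a x = ∑' n : ℕ, (n : ℝ) * coeff a n * x ^ n := by
    rw [h2.tsum_eq_zero_add, dF, ← tsum_mul_left]
    simp only [CharP.cast_eq_zero, zero_mul, zero_add]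
    refine tsum_congr fun n => ?_
    push_cast
    ring
  have h6 := ((h1.mul_left x).hasSum.sub (h2.mul_left x).hasSum)
  rw [tsum_mul_left, tsum_mul_left, ← h3, ← dF] at h6
  have h7 : HasSum (fun n => fluxCoeff a (n + 1) * x ^ (n + 1)) (flux a x) := by
    convert! h6 using 1
    · funext n
      rw [fluxCoeff_succ_eq]
      ring
    · rw [flux]
      ring
  have h8 := (hasSum_nat_add_iff (f := fun n => fluxCoeff a n * x ^ n) 1).1 h7
  rw [Finset.sum_range_one, fluxCoeff_zero, zero_mul, add_zero] at h8
  exact h8.tsum_eq.symm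

lemma fluxCoeff_succ (a : ℝ) (n : ℕ) :
    fluxCoeff a (n + 1) = a * (1 - a) * coeff a n / (n + 1) := by
  rw [fluxCoeff_succ_eq, succ_mul_coeff_sub]

lemma mul_one_sub_pos {a : ℝ} (ha : a ∈ Ioo (0 : ℝ) 1) : 0 < a * (1 - a) :=
  mul_pos ha.1 (sub_pos.2 ha.2)

lemma abs_fluxCoeff_le {a : ℝ} (ha : a ∈ Ioo (0 : ℝ) 1) (n : ℕ) : |fluxCoeff a n| ≤ 1 := by
  cases n with
  | zero => simp [fluxCoeff]
  | succ n =>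
    have h1 := coeff_pos ha n
    have h2 := mul_one_sub_pos ha
    rw [fluxCoeff_succ, abs_of_nonneg (by positivity), div_le_one (by positivity)]
    have h3 := coeff_le_one ha n
    have : (0 : ℝ) ≤ n := n.cast_nonneg
    nlinarith [sq_nonneg (a - 1 / 2)]

/-- The hypergeometric differential equation, in divergence form. -/
lemma hasDerivAt_flux {a x : ℝ} (ha : a ∈ Ioo (0 : ℝ) 1) (hx : |x| < 1) :
    HasDerivAt (flux a) (a * (1 - a) * F a x) x := by
  have h := hasDerivAt_tsum_mul_pow (abs_fluxCoeff_le ha) hx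
  have he : flux a =ᶠ[𝓝 x] fun y => ∑' n, fluxCoeff a n * y ^ n := by
    filter_upwards [(continuous_abs.isOpen_preimage _ isOpen_Iio).mem_nhds
      (show x ∈ abs ⁻¹' Iio 1 from hx)] with y hy
    exact flux_eq_tsum ha hy
  refine (h.congr_of_eventuallyEq he).congr_deriv ?_
  rw [F_eq_tsum, ← tsum_mul_left]
  refine tsum_congr fun n => ?_
  have : ((n : ℝ) + 1) ≠ 0 := by positivity
  rw [fluxCoeff_succ]
  field_simp

/-- `x (1 - x) F'(x)` tends to `sin (π a) / π` as `x → 1`. -/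
lemma tendsto_flux_one {a : ℝ} (ha : a ∈ Ioo (0 : ℝ) 1) :
    Tendsto (flux a) (𝓝[<] 1) (𝓝 (kappa a)) := by
  -- The partial sums telescope to n · coeff n, so Abel's limit theorem applies at 1.
  have h : Tendsto (fun n => ∑ i ∈ Finset.range n, fluxCoeff a i) atTop (𝓝 (kappa a)) := by
    rw [← tendsto_add_atTop_iff_nat 1]
    refine (tendsto_mul_coeff ha).congr fun n => ?_
    rw [Finset.sum_range_succ']
    have := Finset.sum_range_sub (fun n : ℕ => (n : ℝ) * coeff a n) n
    simp only [CharP.cast_eq_zero, zero_mul, sub_zero, Nat.cast_add, Nat.cast_one] at this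
    simp only [fluxCoeff_zero, fluxCoeff_succ_eq, add_zero]
    exact this.symm
  refine (Real.tendsto_tsum_powerSeries_nhdsWithin_lt h).congr' ?_
  filter_upwards [Ioo_mem_nhdsLT (show (-1 : ℝ) < 1 by norm_num)] with x hx
  exact (flux_eq_tsum ha (abs_lt.2 hx)).symm

lemma F_strictMonoOn {a : ℝ} (ha : a ∈ Ioo (0 : ℝ) 1) : StrictMonoOn (F a) (Ico 0 1) := by
  intro x hx y hy hxy
  have hy' : |y| < 1 := by rw [abs_of_nonneg hy.1]; exact hy.2
  have hx' : |x| < 1 := by rw [abs_of_nonneg hx.1]; exact hx.2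
  rw [F_eq_tsum, F_eq_tsum]
  refine Summable.tsum_lt_tsum (i := 1) (fun n => ?_) ?_ (summable_coeff_mul_pow ha hx')
    (summable_coeff_mul_pow ha hy')
  · exact mul_le_mul_of_nonneg_left (pow_le_pow_left₀ hx.1 hxy.le n) (coeff_pos ha n).le
  · simpa using mul_lt_mul_of_pos_left hxy (coeff_pos ha 1)

/-- Each ratio involves a only through (n+a)(n+1-a) = n² + n + a(1-a), and a(1-a) increases up to
1/2. -/
lemma coeff_le_coeff {a b : ℝ} (ha : 0 < a) (hab : a < b) (hb : b ≤ 1 / 2) (n : ℕ) :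
    coeff a n ≤ coeff b n := by
  have ha' : a ∈ Ioo (0 : ℝ) 1 := ⟨ha, by linarith⟩
  induction n with
  | zero => simp [coeff_zero]
  | succ n ih =>
    rw [coeff_succ, coeff_succ]
    have hn : (0 : ℝ) ≤ n := n.cast_nonneg
    have h1 : 0 ≤ (n : ℝ) + 1 - a := by linarith
    have h2 := (coeff_pos ha' n).le.trans ih
    refine mul_le_mul ih ?_ (by positivity) h2
    gcongr ?_ / _
    nlinarith

lemma F_lt_F {a b x : ℝ} (ha : 0 < a) (hab : a < b) (hb : b ≤ 1 / 2) (hx : x ∈ Ioo (0 : ℝ) 1) :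
    F a x < F b x := by
  have ha' : a ∈ Ioo (0 : ℝ) 1 := ⟨ha, by linarith⟩
  have hb' : b ∈ Ioo (0 : ℝ) 1 := ⟨by linarith, by linarith⟩
  have hx' : |x| < 1 := by rw [abs_of_pos hx.1]; exact hx.2
  rw [F_eq_tsum, F_eq_tsum]
  refine Summable.tsum_lt_tsum (i := 1) (fun n => ?_) ?_ (summable_coeff_mul_pow ha' hx')
    (summable_coeff_mul_pow hb' hx')
  · exact mul_le_mul_of_nonneg_right (coeff_le_coeff ha hab hb n) (pow_nonneg hx.1.le n)
  · rw [coeff_one, coeff_one, pow_one]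
    exact mul_lt_mul_of_pos_right (by nlinarith) hx.1

/-! ### Gauss's summation formula for `₂F₁ a (1 - a) (1 + e) 1` -/

/-- The ratio `n! / (1 + e)_n`. -/
noncomputable def pochRatio (e : ℝ) (n : ℕ) : ℝ := ∏ k ∈ Finset.range n, ((k + 1 : ℝ) / (k + 1 + e))

lemma pochRatio_zero (e : ℝ) : pochRatio e 0 = 1 := by simp [pochRatio]

lemma pochRatio_succ (e : ℝ) (n : ℕ) :
    pochRatio e (n + 1) = pochRatio e n * ((n + 1) / (n + 1 + e)) := by
  rw [pochRatio, Finset.prod_range_succ, ← pochRatio]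

lemma pochRatio_pos {e : ℝ} (he : 0 ≤ e) (n : ℕ) : 0 < pochRatio e n :=
  Finset.prod_pos fun k _ => by positivity

lemma pochRatio_antitone {e f : ℝ} (he : 0 ≤ e) (hef : e ≤ f) (n : ℕ) :
    pochRatio f n ≤ pochRatio e n := by
  have hf := he.trans hef
  refine Finset.prod_le_prod (fun k _ => by positivity) fun k _ => ?_
  gcongr

lemma pochRatio_zero_left (n : ℕ) : pochRatio 0 n = 1 :=
  Finset.prod_eq_one fun k _ => by
    have : (k : ℝ) + 1 ≠ 0 := by positivity
    rw [add_zero, div_self this]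

lemma pochRatio_le_one {e : ℝ} (he : 0 ≤ e) (n : ℕ) : pochRatio e n ≤ 1 :=
  (pochRatio_antitone le_rfl he n).trans_eq (pochRatio_zero_left n)

lemma pochRatio_add_one {e : ℝ} (he : 0 ≤ e) (n : ℕ) :
    pochRatio (e + 1) n = pochRatio e n * ((1 + e) / (1 + e + n)) := by
  induction n with
  | zero =>
    have : 1 + e ≠ 0 := by positivity
    simp [pochRatio_zero, this]
  | succ n ih =>
    rw [pochRatio_succ, pochRatio_succ, ih]
    push_cast
    have h1 : 1 + e + n ≠ 0 := by positivity
    have h2 : n + 1 + (e + 1) ≠ 0 := by positivity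
    have h3 : 1 + e + (n + 1) ≠ 0 := by positivity
    have h4 : n + 1 + e ≠ 0 := by positivity
    field_simp
    ring

/-- Up to the factor e n^{-e}, this ratio is Euler's sequence for Γ(e). -/
lemma tendsto_pochRatio_atTop {e : ℝ} (he : 0 < e) :
    Tendsto (pochRatio e) atTop (𝓝 0) := by
  have h1 := ((tendsto_rpow_neg_atTop he).comp tendsto_natCast_atTop_atTop).mul
    ((Real.GammaSeq_tendsto_Gamma e).const_mul e)
  rw [zero_mul] at h1
  refine h1.congr' ?_
  filter_upwards [eventually_gt_atTop 0] with n hn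
  have hn' : (0 : ℝ) < n := by exact_mod_cast hn
  have h2 : ∀ m : ℕ, pochRatio e m * ∏ j ∈ Finset.range m, (e + (j + 1 : ℕ)) = m.factorial := by
    intro m
    induction m with
    | zero => simp [pochRatio_zero]
    | succ m ih =>
      rw [pochRatio_succ, Finset.prod_range_succ, Nat.factorial_succ]
      push_cast at ih ⊢
      rw [← ih]
      have : (m : ℝ) + 1 + e ≠ 0 := by positivity
      field_simp
      ring
  have h3 : ∏ j ∈ Finset.range n, (e + (j + 1 : ℕ)) ≠ 0 :=
    Finset.prod_ne_zero_iff.2 fun j _ => by positivity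
  simp only [Function.comp_apply]
  rw [Real.GammaSeq, Finset.prod_range_succ', ← h2, Real.rpow_neg hn'.le]
  have h4 : (n : ℝ) ^ e ≠ 0 := by positivity
  simp only [CharP.cast_eq_zero, add_zero]
  field_simp

lemma pochRatio_succ_div {e : ℝ} (he : 0 < e) (n : ℕ) :
    pochRatio e (n + 1) / (n + 1 : ℕ) = (pochRatio e n - pochRatio e (n + 1)) / e := by
  have h1 : (n : ℝ) + 1 ≠ 0 := by positivity
  have h2 : (n : ℝ) + 1 + e ≠ 0 := by positivity
  rw [pochRatio_succ]
  push_cast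
  field_simp
  ring

/-- The terms telescope by `pochRatio_succ_div`; the term n = 0 is a division by zero, hence 0. This
is the perturbed harmonic series subtracted in `tsum_coeff_sub`. -/
lemma hasSum_pochRatio_div {e : ℝ} (he : 0 < e) :
    HasSum (fun n : ℕ => pochRatio e n / n) (1 / e) := by
  have h : HasSum (fun n : ℕ => pochRatio e (n + 1) / (n + 1 : ℕ)) (1 / e) := by
    rw [hasSum_iff_tendsto_nat_of_nonneg
      (fun n => by have := pochRatio_pos he.le (n + 1); positivity)]
    have h1 := ((tendsto_pochRatio_atTop he).const_sub 1).div_const e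
    rw [sub_zero] at h1
    refine h1.congr fun n => ?_
    simp only [pochRatio_succ_div he]
    rw [← Finset.sum_div, Finset.sum_range_sub', pochRatio_zero]
  have := (hasSum_nat_add_iff (f := fun n : ℕ => pochRatio e n / n) 1).1 h
  simpa using this

lemma summable_coeff_mul_pochRatio {a e : ℝ} (ha : a ∈ Ioo (0 : ℝ) 1) (he : 0 < e) :
    Summable fun n => coeff a n * pochRatio e n := by
  rw [← summable_nat_add_iff 1]
  refine Summable.of_nonneg_of_le (fun n => (mul_pos (coeff_pos ha _) (pochRatio_pos he.le _)).le)
    (fun n => ?_) (((summable_nat_add_iff 1).2 (hasSum_pochRatio_div he).summable).mul_left (kappa a))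
  have h1 := mul_coeff_le_kappa ha (n + 1)
  have h2 := pochRatio_pos he.le (n + 1)
  rw [← mul_div_assoc, le_div_iff₀ (by positivity)]
  calc _ = ((n + 1 : ℕ) * coeff a (n + 1)) * pochRatio e (n + 1) := by ring
    _ ≤ _ := mul_le_mul_of_nonneg_right h1 h2.le

/-- The value at `1` of the hypergeometric series with parameters `a`, `1 - a`, `1 + e`. -/
noncomputable def gaussSum (a e : ℝ) : ℝ := ∑' n, coeff a n * pochRatio e n

/-- Gauss's contiguity relation at `1`. -/
lemma gaussSum_contiguous {a e : ℝ} (ha : a ∈ Ioo (0 : ℝ) 1) (he : 0 < e) :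
    e * (1 + e) * gaussSum a e = (1 + e - a) * (e + a) * gaussSum a (e + 1) := by
  have s1 := ((summable_coeff_mul_pochRatio ha he).hasSum.mul_left (e * (1 + e))).sub
    ((summable_coeff_mul_pochRatio ha (e := e + 1) (by positivity)).hasSum.mul_left
      ((1 + e - a) * (e + a)))
  have ht : Tendsto (fun n : ℕ => n * (coeff a n * pochRatio e n)) atTop (𝓝 0) := by
    have := (tendsto_mul_coeff ha).mul (tendsto_pochRatio_atTop he)
    rw [mul_zero] at this
    exact this.congr fun n => mul_assoc _ _ _
  have h0 := s1.tendsto_sum_nat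
  -- Telescoping certificate: the combination of terms is T_n - T_{n+1} with T_n = (1+e) n coeff_n
  -- pochRatio_n. Here T_0 = 0 and T_n → 0.
  have h1 : ∀ n : ℕ, e * (1 + e) * (coeff a n * pochRatio e n) -
      (1 + e - a) * (e + a) * (coeff a n * pochRatio (e + 1) n) =
      (1 + e) * ((n : ℝ) * (coeff a n * pochRatio e n)) -
        (1 + e) * (((n + 1 : ℕ) : ℝ) * (coeff a (n + 1) * pochRatio e (n + 1))) := by
    intro n
    rw [coeff_succ, pochRatio_succ, pochRatio_add_one he.le]
    push_cast
    have h1 : 1 + e + n ≠ 0 := by positivity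
    have h3 : (n : ℝ) + 1 ≠ 0 := by positivity
    have h4 : n + 1 + e ≠ 0 := by positivity
    field_simp
    ring
  simp only [h1] at h0
  have h2 : Tendsto (fun N : ℕ => ∑ n ∈ Finset.range N,
      ((1 + e) * ((n : ℝ) * (coeff a n * pochRatio e n)) -
        (1 + e) * (((n + 1 : ℕ) : ℝ) * (coeff a (n + 1) * pochRatio e (n + 1)))))
      atTop (𝓝 0) := by
    have h3 := ht.const_mul (-(1 + e))
    rw [mul_zero] at h3
    refine h3.congr fun N => ?_
    rw [Finset.sum_range_sub' (fun n : ℕ => (1 + e) * ((n : ℝ) * (coeff a n * pochRatio e n)))]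
    simp only [CharP.cast_eq_zero, zero_mul, mul_zero, zero_sub, neg_mul]
  have := tendsto_nhds_unique h0 h2
  rw [gaussSum, gaussSum]
  linarith

/-- Every term except n = 0 dies as the parameter grows, and the series at N = 0 dominates because
`pochRatio` decreases in its parameter. -/
lemma tendsto_gaussSum_add_nat {a e : ℝ} (ha : a ∈ Ioo (0 : ℝ) 1) (he : 0 < e) :
    Tendsto (fun N : ℕ => gaussSum a (e + N)) atTop (𝓝 1) := by
  have h := tendsto_tsum_of_dominated_convergence (𝓕 := atTop)
    (f := fun (N : ℕ) (n : ℕ) => coeff a n * pochRatio (e + N) n)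
    (g := fun n => if n = 0 then (1 : ℝ) else 0)
    (summable_coeff_mul_pochRatio ha he) (fun n => ?_) (.of_forall fun N n => ?_)
  · rw [tsum_ite_eq 0 (fun _ => (1 : ℝ))] at h
    exact h
  · cases n with
    | zero => simp [coeff_zero, pochRatio_zero]
    | succ n =>
      simp only [Nat.add_eq_zero_iff, one_ne_zero, and_false, if_false]
      rw [← mul_zero (coeff a (n + 1))]
      refine Tendsto.const_mul _ ?_
      have h1 : Tendsto (fun N : ℕ => ((n : ℝ) + 1) / (n + 1 + (e + N))) atTop (𝓝 0) := by
        refine Tendsto.const_div_atTop ?_ _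
        refine tendsto_atTop_add_const_left _ _ (tendsto_atTop_add_const_left _ _ ?_)
        exact tendsto_natCast_atTop_atTop
      refine squeeze_zero (fun N => (pochRatio_pos (by positivity) _).le) (fun N => ?_) h1
      rw [pochRatio_succ]
      exact mul_le_of_le_one_left (by positivity) (pochRatio_le_one (by positivity) n)
  · have h1 := coeff_pos ha n
    have h2 := pochRatio_pos (show 0 ≤ e + N by positivity) n
    rw [Real.norm_of_nonneg (by positivity)]
    exact mul_le_mul_of_nonneg_left (pochRatio_antitone he.le (by simp) n) h1.le

lemma tendsto_Gamma_add_nat_div {x : ℝ} (hx : 0 < x) :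
    Tendsto (fun N : ℕ => Real.Gamma (x + (N + 1 : ℕ)) / ((N : ℝ) ^ x * N.factorial)) atTop
      (𝓝 1) := by
  have hG := Real.Gamma_pos_of_pos hx
  have h1 := (Real.GammaSeq_tendsto_Gamma x).inv₀ hG.ne' |>.const_mul (Real.Gamma x)
  rw [mul_inv_cancel₀ hG.ne'] at h1
  refine h1.congr fun N => ?_
  have h2 : ∀ m : ℕ, Real.Gamma (x + m) = Real.Gamma x * ∏ j ∈ Finset.range m, (x + j) := by
    intro m
    induction m with
    | zero => simp
    | succ m ih =>
      rw [Finset.prod_range_succ, ← mul_assoc, ← ih]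
      push_cast
      rw [← add_assoc, Real.Gamma_add_one (by positivity), mul_comm]
  rw [h2, Real.GammaSeq, inv_div, mul_div_assoc]

/-- The right-hand side of Gauss's formula. -/
noncomputable def gaussGamma (a e : ℝ) : ℝ :=
  Real.Gamma (1 + e) * Real.Gamma e / (Real.Gamma (1 + e - a) * Real.Gamma (e + a))

lemma gaussGamma_pos {a e : ℝ} (ha : a ∈ Ioo (0 : ℝ) 1) (he : 0 < e) : 0 < gaussGamma a e := by
  have h1 := Real.Gamma_pos_of_pos he
  have h2 := Real.Gamma_pos_of_pos (show 0 < 1 + e by positivity)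
  have h3 := Real.Gamma_pos_of_pos (show 0 < 1 + e - a by linarith [ha.2])
  have h4 := Real.Gamma_pos_of_pos (show 0 < e + a by linarith [ha.1])
  unfold gaussGamma
  positivity

lemma gaussGamma_contiguous {a e : ℝ} (ha : a ∈ Ioo (0 : ℝ) 1) (he : 0 < e) :
    e * (1 + e) * gaussGamma a e = (1 + e - a) * (e + a) * gaussGamma a (e + 1) := by
  have h2 : 0 < 1 + e := by positivity
  have h3 : 0 < 1 + e - a := by linarith [ha.2]
  have h4 : 0 < e + a := by linarith [ha.1]
  have g3 := (Real.Gamma_pos_of_pos h3).ne'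
  have g4 := (Real.Gamma_pos_of_pos h4).ne'
  have e2 : Real.Gamma (1 + (e + 1)) = (1 + e) * Real.Gamma (1 + e) := by
    rw [← Real.Gamma_add_one h2.ne']; ring_nf
  have e3 : Real.Gamma (1 + (e + 1) - a) = (1 + e - a) * Real.Gamma (1 + e - a) := by
    rw [← Real.Gamma_add_one h3.ne']; ring_nf
  have e4 : Real.Gamma (e + 1 + a) = (e + a) * Real.Gamma (e + a) := by
    rw [← Real.Gamma_add_one h4.ne']; ring_nf
  rw [gaussGamma, gaussGamma, e2, e3, e4, Real.Gamma_add_one he.ne']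
  field_simp

/-- Γ(x+N+1) ~ N^x N!, and the exponents balance: (1+e) + e = (1+e-a) + (e+a). -/
lemma tendsto_gaussGamma_add_nat {a e : ℝ} (ha : a ∈ Ioo (0 : ℝ) 1) (he : 0 < e) :
    Tendsto (fun N : ℕ => gaussGamma a (e + N)) atTop (𝓝 1) := by
  have h2 : 0 < 1 + e := by positivity
  have h3 : 0 < 1 + e - a := by linarith [ha.2]
  have h4 : 0 < e + a := by linarith [ha.1]
  rw [← tendsto_add_atTop_iff_nat 1]
  have h := ((tendsto_Gamma_add_nat_div h2).mul (tendsto_Gamma_add_nat_div he)).div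
    ((tendsto_Gamma_add_nat_div h3).mul (tendsto_Gamma_add_nat_div h4)) (by norm_num)
  simp only [mul_one, div_one] at h
  refine h.congr' ?_
  filter_upwards [eventually_gt_atTop 0] with N hN
  have hN' : (0 : ℝ) < N := by exact_mod_cast hN
  have e1 : (N : ℝ) ^ (1 + e) * (N : ℝ) ^ e = (N : ℝ) ^ (1 + e - a) * (N : ℝ) ^ (e + a) := by
    rw [← Real.rpow_add hN', ← Real.rpow_add hN']
    ring_nf
  have hf : (N.factorial : ℝ) ≠ 0 := by positivity
  have p3 : (N : ℝ) ^ (1 + e - a) ≠ 0 := by positivity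
  have p4 : (N : ℝ) ^ (e + a) ≠ 0 := by positivity
  have g3 := (Real.Gamma_pos_of_pos (show 0 < 1 + e - a + (N + 1 : ℕ) by positivity)).ne'
  have g4 := (Real.Gamma_pos_of_pos (show 0 < e + a + (N + 1 : ℕ) by positivity)).ne'
  rw [gaussGamma, show 1 + (e + (N + 1 : ℕ)) = 1 + e + (N + 1 : ℕ) by ring,
    show 1 + e + (N + 1 : ℕ) - a = 1 + e - a + (N + 1 : ℕ) by ring,
    show e + (N + 1 : ℕ) + a = e + a + (N + 1 : ℕ) by ring]
  simp only [Pi.div_apply]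
  rw [div_mul_div_comm, div_mul_div_comm, mul_mul_mul_comm ((N : ℝ) ^ (1 + e)), e1]
  field_simp

/-- Gauss's summation formula. -/
lemma gaussSum_eq_gaussGamma {a e : ℝ} (ha : a ∈ Ioo (0 : ℝ) 1) (he : 0 < e) :
    gaussSum a e = gaussGamma a e := by
  -- Both sides obey the same contiguity relation, so their quotient is unchanged by e ↦ e + 1; it
  -- tends to 1 along e + N.
  have h1 : ∀ N : ℕ, gaussSum a e / gaussGamma a e = gaussSum a (e + N) / gaussGamma a (e + N) := by
    intro N
    induction N with
    | zero => simp
    | succ N ih =>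
      have hN : 0 < e + N := by positivity
      have s := gaussSum_contiguous ha hN
      have g := gaussGamma_contiguous ha hN
      have q1 := gaussGamma_pos ha hN
      have q2 := gaussGamma_pos ha (show 0 < e + N + 1 by positivity)
      have h3 : 0 < 1 + (e + N) - a := by linarith [ha.2]
      have h4 : 0 < e + N + a := by linarith [ha.1]
      rw [ih]
      push_cast
      rw [← add_assoc, div_eq_div_iff q1.ne' q2.ne']
      have h5 : (e + N) * (1 + (e + N)) ≠ 0 := by positivity
      have h6 : (1 + (e + N) - a) * (e + N + a) ≠ 0 := by positivity
      refine mul_left_cancel₀ (mul_ne_zero h5 h6) ?_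
      linear_combination (1 + (e + N) - a) * (e + N + a) * gaussGamma a (e + N + 1) * s -
        (1 + (e + N) - a) * (e + N + a) * gaussSum a (e + N + 1) * g
  have h2 := (tendsto_gaussSum_add_nat ha he).div (tendsto_gaussGamma_add_nat ha he) one_ne_zero
  have h3 := tendsto_nhds_unique (tendsto_const_nhds.congr h1) h2
  rw [div_one, div_eq_one_iff_eq (gaussGamma_pos ha he).ne'] at h3
  exact h3

/-! ### Logarithmic asymptotics of `F a` at `1` -/

/-- At n = 0 the quotient κ/0 is 0, so the difference is the constant term 1 of the series. -/
lemma abs_coeff_sub_le' {a : ℝ} (ha : a ∈ Ioo (0 : ℝ) 1) (n : ℕ) :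
    |coeff a n - kappa a / n| ≤ if n = 0 then 1 else kappa a * (1 / (n : ℝ) ^ 2) := by
  cases n with
  | zero => simp [coeff_zero]
  | succ n => simpa using abs_coeff_sub_le ha n

lemma summable_coeff_sub_bound (a : ℝ) :
    Summable fun n : ℕ => if n = 0 then 1 else kappa a * (1 / (n : ℝ) ^ 2) := by
  rw [← summable_nat_add_iff 1]
  simpa using summable_coeff_sub a

lemma hasDerivAt_gamma_quotient {a : ℝ} (ha : a ∈ Ioo (0 : ℝ) 1) :
    HasDerivAt (fun e : ℝ => Real.Gamma (1 + e) * Real.Gamma (1 + e) /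
      (Real.Gamma (1 + e - a) * Real.Gamma (e + a))) (kappa a * R a) 0 := by
  have hd : ∀ {x : ℝ}, 0 < x → HasDerivAt Real.Gamma (deriv Real.Gamma x) x := fun {x} hx =>
    (Real.differentiableAt_Gamma fun m => by
      have : (0 : ℝ) ≤ m := m.cast_nonneg
      linarith).hasDerivAt
  have h1 : HasDerivAt (fun e : ℝ => Real.Gamma (1 + e)) (-Real.eulerMascheroniConstant) 0 := by
    have := Real.hasDerivAt_Gamma_one
    rw [show (1 : ℝ) = 1 + 0 by ring] at this
    exact this.comp_const_add 1 0
  have h2 : HasDerivAt (fun e : ℝ => Real.Gamma (1 + e - a)) (deriv Real.Gamma (1 - a)) 0 := by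
    have := hd (sub_pos.2 ha.2)
    rw [show 1 - a = (1 - a) + 0 by ring] at this
    have := this.comp_const_add (1 - a) 0
    convert! this using 2
    · ring_nf
    · ring_nf
  have h3 : HasDerivAt (fun e : ℝ => Real.Gamma (e + a)) (deriv Real.Gamma a) 0 := by
    have := hd ha.1
    nth_rewrite 2 [show a = 0 + a by ring] at this
    exact this.comp_add_const 0 a
  have g1 := (Real.Gamma_pos_of_pos ha.1).ne'
  have g2 := (Real.Gamma_pos_of_pos (sub_pos.2 ha.2)).ne'
  refine ((h1.mul h1).div (h2.mul h3) (by simp [g1, g2])).congr_deriv ?_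
  have hk : kappa a = (Real.Gamma a * Real.Gamma (1 - a))⁻¹ := by
    rw [Gamma_mul_Gamma_one_sub_eq_inv_kappa, inv_inv]
  rw [hk, R, psi, psi]
  simp only [Pi.mul_apply, add_zero, zero_add, Real.Gamma_one]
  field_simp
  ring

/-- For e > 0 the sum weighted by `pochRatio e` splits into Gauss's value minus κ/e. This is the
slope at 0 of the quotient in `hasDerivAt_gamma_quotient`, whose value at 0 is κ. Dominated
convergence removes the weight as e → 0. -/
lemma tsum_coeff_sub {a : ℝ} (ha : a ∈ Ioo (0 : ℝ) 1) :
    ∑' n : ℕ, (coeff a n - kappa a / n) = kappa a * R a := by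
  have hB := summable_coeff_sub_bound a
  have h1 : Tendsto (fun e : ℝ => ∑' n : ℕ, (coeff a n - kappa a / n) * pochRatio e n) (𝓝[>] 0)
      (𝓝 (∑' n : ℕ, (coeff a n - kappa a / n))) := by
    refine tendsto_tsum_of_dominated_convergence hB (fun n => ?_) ?_
    · have hc : ContinuousAt (fun e => pochRatio e n) 0 := by
        unfold pochRatio
        refine tendsto_finsetProd _ fun k _ => ?_
        refine ContinuousAt.div continuousAt_const (by fun_prop) ?_
        positivity
      have h2 := (hc.tendsto.mono_left (nhdsWithin_le_nhds (s := Ioi 0))).const_mul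
        (coeff a n - kappa a / n)
      rwa [pochRatio_zero_left, mul_one] at h2
    · filter_upwards [self_mem_nhdsWithin] with e he n
      have he : (0 : ℝ) < e := he
      rw [norm_mul, Real.norm_eq_abs, Real.norm_of_nonneg (pochRatio_pos he.le n).le]
      exact (mul_le_of_le_one_right (abs_nonneg _) (pochRatio_le_one he.le n)).trans
        (abs_coeff_sub_le' ha n)
  have h2 := (hasDerivAt_iff_tendsto_slope.1 (hasDerivAt_gamma_quotient ha)).mono_left
    (nhdsWithin_mono 0 (fun x (hx : 0 < x) => hx.ne'))
  refine tendsto_nhds_unique h1 (h2.congr' ?_)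
  filter_upwards [self_mem_nhdsWithin] with e he
  have he : (0 : ℝ) < e := he
  have h3 := (summable_coeff_mul_pochRatio ha he).hasSum.sub
    ((hasSum_pochRatio_div he).mul_left (kappa a))
  rw [← gaussSum, gaussSum_eq_gaussGamma ha he] at h3
  have h4 : ∑' n : ℕ, (coeff a n - kappa a / n) * pochRatio e n =
      gaussGamma a e - kappa a * (1 / e) := by
    rw [← h3.tsum_eq]
    exact tsum_congr fun n => by ring
  rw [h4, slope_def_field, gaussGamma]
  have e1 : Real.Gamma (1 + e) = e * Real.Gamma e := by
    rw [add_comm, Real.Gamma_add_one he.ne']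
  have hk : kappa a = (Real.Gamma (1 - a) * Real.Gamma a)⁻¹ := by
    rw [mul_comm, Gamma_mul_Gamma_one_sub_eq_inv_kappa, inv_inv]
  simp only [add_zero, zero_add, Real.Gamma_one, mul_one, sub_zero]
  rw [hk]
  nth_rewrite 2 [e1]
  field_simp

lemma tendsto_one_sub_nhdsGT_zero : Tendsto (fun x : ℝ => 1 - x) (𝓝[>] 0) (𝓝[<] 1) := by
  refine tendsto_nhdsWithin_iff.2 ⟨?_, ?_⟩
  · have : Tendsto (fun x : ℝ => 1 - x) (𝓝 0) (𝓝 (1 - 0)) :=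
      (continuous_const.sub continuous_id).tendsto 0
    rw [sub_zero] at this
    exact this.mono_left nhdsWithin_le_nhds
  · filter_upwards [self_mem_nhdsWithin] with x hx
    have hx : (0 : ℝ) < x := hx
    show 1 - x < 1
    linarith

lemma tendsto_F_add_log {a : ℝ} (ha : a ∈ Ioo (0 : ℝ) 1) :
    Tendsto (fun x => F a (1 - x) + kappa a * Real.log x) (𝓝[>] 0) (𝓝 (kappa a * R a)) := by
  have hs : Summable fun n : ℕ => coeff a n - kappa a / n :=
    Summable.of_norm_bounded (summable_coeff_sub_bound a) (abs_coeff_sub_le' ha)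
  have h1 := Real.tendsto_tsum_powerSeries_nhdsWithin_lt hs.hasSum.tendsto_sum_nat
  rw [tsum_coeff_sub ha] at h1
  refine (h1.comp tendsto_one_sub_nhdsGT_zero).congr' ?_
  filter_upwards [Ioo_mem_nhdsGT (show (0 : ℝ) < 1 by norm_num)] with x hx
  have hx' : |1 - x| < 1 := by rw [abs_lt]; constructor <;> linarith [hx.1, hx.2]
  have h3 := Real.hasSum_pow_div_log_of_abs_lt_one hx'
  have h4 : HasSum (fun n : ℕ => (1 - x) ^ n / n) (-Real.log x) := by
    have := (hasSum_nat_add_iff (f := fun n : ℕ => (1 - x) ^ n / n) 1).1 (by simpa using h3)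
    simpa using this
  have h5 := (summable_coeff_mul_pow ha hx').hasSum.sub (h4.mul_left (kappa a))
  rw [← F_eq_tsum] at h5
  rw [Function.comp_apply]
  have h6 : F a (1 - x) + kappa a * Real.log x = F a (1 - x) - kappa a * -Real.log x := by ring
  rw [h6, ← h5.tsum_eq]
  exact tsum_congr fun n => by ring

/-! ### The modulus as a function of `x = r ^ 2` -/

/-- The function `x ↦ μ_a (√x)`. -/
noncomputable def modulus (a x : ℝ) : ℝ :=
  Real.pi / (2 * Real.sin (Real.pi * a)) * (F a (1 - x) / F a x)

lemma mu_eq_modulus (a r : ℝ) : mu a r = modulus a (r ^ 2) := rfl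

lemma muStar_eq_modulus (a r : ℝ) : muStar a r = modulus a (r ^ 3) := rfl

lemma modulus_eq (a x : ℝ) : modulus a x = (2 * kappa a)⁻¹ * (F a (1 - x) / F a x) := by
  rw [modulus, kappa, ← mul_div_assoc 2, inv_div]

lemma modulus_pos {a x : ℝ} (ha : a ∈ Ioo (0 : ℝ) 1) (hx : x ∈ Ioo (0 : ℝ) 1) :
    0 < modulus a x := by
  have h1 := F_pos ha (Ioo_subset_Ico_self hx)
  have h2 := F_pos ha (x := 1 - x) ⟨by linarith [hx.2], by linarith [hx.1]⟩
  have h3 := kappa_pos ha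
  rw [modulus_eq]
  positivity

lemma modulus_strictAntiOn {a : ℝ} (ha : a ∈ Ioo (0 : ℝ) 1) :
    StrictAntiOn (modulus a) (Ioo 0 1) := by
  intro x hx y hy hxy
  have h1 := F_pos ha (Ioo_subset_Ico_self hx)
  have h2 := F_pos ha (x := 1 - y) ⟨by linarith [hy.2], by linarith [hy.1]⟩
  have h3 := kappa_pos ha
  rw [modulus_eq, modulus_eq]
  refine mul_lt_mul_of_pos_left ?_ (by positivity)
  refine div_lt_div₀ ?_ ?_ (h2.le.trans ?_) h1
  · exact F_strictMonoOn ha ⟨by linarith [hy.2], by linarith [hy.1]⟩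
      ⟨by linarith [hx.2], by linarith [hx.1]⟩ (by linarith)
  · exact (F_strictMonoOn ha (Ioo_subset_Ico_self hx) (Ioo_subset_Ico_self hy) hxy).le
  · exact (F_strictMonoOn ha ⟨by linarith [hy.2], by linarith [hy.1]⟩
      ⟨by linarith [hx.2], by linarith [hx.1]⟩ (by linarith)).le

lemma abs_lt_one_of_mem {x : ℝ} (hx : x ∈ Ioo (0 : ℝ) 1) : |x| < 1 := by
  rw [abs_of_pos hx.1]; exact hx.2

lemma one_sub_mem {x : ℝ} (hx : x ∈ Ioo (0 : ℝ) 1) : 1 - x ∈ Ioo (0 : ℝ) 1 :=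
  ⟨by linarith [hx.2], by linarith [hx.1]⟩

lemma hasDerivAt_F_one_sub {a x : ℝ} (ha : a ∈ Ioo (0 : ℝ) 1) (hx : x ∈ Ioo (0 : ℝ) 1) :
    HasDerivAt (fun x => F a (1 - x)) (-dF a (1 - x)) x := by
  have h := hasDerivAt_F ha (abs_lt_one_of_mem (one_sub_mem hx))
  have := h.comp_const_sub 1 x
  exact this

lemma hasDerivAt_flux_one_sub {a x : ℝ} (ha : a ∈ Ioo (0 : ℝ) 1) (hx : x ∈ Ioo (0 : ℝ) 1) :
    HasDerivAt (fun x => flux a (1 - x)) (-(a * (1 - a) * F a (1 - x))) x := by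
  have h := hasDerivAt_flux ha (abs_lt_one_of_mem (one_sub_mem hx))
  exact h.comp_const_sub 1 x

lemma tendsto_F_zero {a : ℝ} (ha : a ∈ Ioo (0 : ℝ) 1) : Tendsto (F a) (𝓝[>] 0) (𝓝 1) := by
  have := (hasDerivAt_F ha (x := 0) (by simp)).continuousAt.tendsto
  rw [F_zero] at this
  exact this.mono_left nhdsWithin_le_nhds

lemma tendsto_id_mul_log : Tendsto (fun x : ℝ => x * Real.log x) (𝓝[>] 0) (𝓝 0) := by
  have h := Real.continuous_mul_log.tendsto 0
  simp only [Real.log_zero, mul_zero] at h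
  exact h.mono_left nhdsWithin_le_nhds

/-- The generalized Legendre relation. -/
lemma wronskian_eq {a x : ℝ} (ha : a ∈ Ioo (0 : ℝ) 1) (hx : x ∈ Ioo (0 : ℝ) 1) :
    flux a x * F a (1 - x) + F a x * flux a (1 - x) = kappa a := by
  set W : ℝ → ℝ := fun x => flux a x * F a (1 - x) + F a x * flux a (1 - x) with hW
  -- By the divergence form of the equation, the terms a(1-a)F(y)F(1-y) cancel, and so do the
  -- products of the two derivatives.
  have hd : ∀ y ∈ Ioo (0 : ℝ) 1, HasDerivAt W 0 y := by
    intro y hy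
    have hy' := abs_lt_one_of_mem hy
    refine (((hasDerivAt_flux ha hy').mul (hasDerivAt_F_one_sub ha hy)).add
      ((hasDerivAt_F ha hy').mul (hasDerivAt_flux_one_sub ha hy))).congr_deriv ?_
    simp only [flux]
    ring
  have hconst : ∀ y ∈ Ioo (0 : ℝ) 1, W y = W x := fun y hy =>
    isOpen_Ioo.is_const_of_deriv_eq_zero isPreconnected_Ioo
      (fun z hz => (hd z hz).differentiableAt.differentiableWithinAt)
      (fun z hz => (hd z hz).deriv) hy hx
  -- Near 0 the first summand is O(x log x); the second tends to F(0) = 1 times the flux limit κ.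
  have hlim : Tendsto W (𝓝[>] 0) (𝓝 (kappa a)) := by
    have h1 := (tendsto_flux_one ha).comp tendsto_one_sub_nhdsGT_zero
    have h2 := (tendsto_F_zero ha).mul h1
    have hdF : Tendsto (fun x => (1 - x) * dF a x) (𝓝[>] 0) (𝓝 (dF a 0)) := by
      have hc : ContinuousAt (dF a) 0 :=
        (hasDerivAt_tsum_mul_pow (abs_succ_mul_coeff_le ha) (by simp)).continuousAt
      have h1 : ContinuousAt (fun x => (1 - x) * dF a x) 0 :=
        (continuousAt_const.sub continuousAt_id).mul hc
      simpa using h1.tendsto.mono_left (nhdsWithin_le_nhds (s := Ioi 0))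
    have h3 : Tendsto (fun x => x * F a (1 - x)) (𝓝[>] 0) (𝓝 0) := by
      have hid : Tendsto (fun x : ℝ => x) (𝓝[>] 0) (𝓝 0) :=
        tendsto_id.mono_left nhdsWithin_le_nhds
      have := (hid.mul (tendsto_F_add_log ha)).sub (tendsto_id_mul_log.const_mul (kappa a))
      simp only [zero_mul, mul_zero, sub_zero] at this
      exact this.congr fun x => by ring
    have h4 := (hdF.mul h3).add h2
    simp only [mul_zero, zero_add, one_mul] at h4
    refine h4.congr fun x => ?_
    simp only [hW, Function.comp_apply, flux]
    ring
  refine tendsto_nhds_unique (tendsto_const_nhds.congr' ?_) hlim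
  filter_upwards [Ioo_mem_nhdsGT (show (0 : ℝ) < 1 by norm_num)] with y hy
  exact (hconst y hy).symm

/-- The numerator of the quotient rule is the Wronskian, so κ cancels and a survives only through F.
-/
lemma hasDerivAt_modulus {a x : ℝ} (ha : a ∈ Ioo (0 : ℝ) 1) (hx : x ∈ Ioo (0 : ℝ) 1) :
    HasDerivAt (modulus a) (-(1 / (2 * x * (1 - x) * F a x ^ 2))) x := by
  have hF := (F_pos ha (Ioo_subset_Ico_self hx)).ne'
  have h := ((hasDerivAt_F_one_sub ha hx).div (hasDerivAt_F ha (abs_lt_one_of_mem hx)) hF).const_mul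
    (2 * kappa a)⁻¹
  have he : modulus a = fun x => (2 * kappa a)⁻¹ * (F a (1 - x) / F a x) :=
    funext (modulus_eq a)
  rw [he]
  refine h.congr_deriv ?_
  have hk := (kappa_pos ha).ne'
  have hx0 := hx.1.ne'
  have hx1 := (one_sub_mem hx).1.ne'
  have hw := wronskian_eq ha hx
  rw [flux, flux] at hw
  field_simp
  linear_combination -hw

lemma tendsto_modulus_add_log {a : ℝ} (ha : a ∈ Ioo (0 : ℝ) 1) :
    Tendsto (fun x => modulus a x + 1 / 2 * Real.log x) (𝓝[>] 0) (𝓝 (R a / 2)) := by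
  have hk := (kappa_pos ha).ne'
  have h1 := ((tendsto_F_add_log ha).div (tendsto_F_zero ha) one_ne_zero).const_mul (2 * kappa a)⁻¹
  have h2 : Tendsto (fun x => (F a x - 1) / x) (𝓝[>] 0) (𝓝 (dF a 0)) := by
    have := (hasDerivAt_iff_tendsto_slope.1 (hasDerivAt_F ha (x := 0) (by simp))).mono_left
      (nhdsWithin_mono 0 (fun x (hx : 0 < x) => hx.ne'))
    refine this.congr fun x => ?_
    rw [slope_def_field, F_zero, sub_zero]
  -- Correction for dividing κ log x by F(x) instead of 1: ½ log x (F-1)/F = ½ ((F-1)/x)(x log x)/F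
  -- → 0.
  have h3 := ((h2.mul tendsto_id_mul_log).div (tendsto_F_zero ha) one_ne_zero).const_mul (1 / 2)
  have h4 := h1.add h3
  simp only [mul_zero, div_one, add_zero] at h4
  have e : (2 * kappa a)⁻¹ * (kappa a * R a) = R a / 2 := by field_simp
  rw [e] at h4
  refine h4.congr' ?_
  filter_upwards [Ioo_mem_nhdsGT (show (0 : ℝ) < 1 by norm_num)] with x hx
  have hF := (F_pos ha (Ioo_subset_Ico_self hx)).ne'
  have hx0 := hx.1.ne'
  simp only [Pi.div_apply]
  rw [modulus_eq]
  field_simp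
  ring

lemma tendsto_modulus_one {a : ℝ} (ha : a ∈ Ioo (0 : ℝ) 1) :
    Tendsto (modulus a) (𝓝[<] 1) (𝓝 0) := by
  have hk := kappa_pos ha
  have hlog : Tendsto (fun x => F a (1 - x)) (𝓝[>] 0) atTop := by
    have h1 : Tendsto (fun x => -(kappa a * Real.log x)) (𝓝[>] 0) atTop :=
      tendsto_neg_atBot_atTop.comp (Real.tendsto_log_nhdsGT_zero.const_mul_atBot hk)
    refine ((tendsto_F_add_log ha).add_atTop h1).congr fun x => ?_
    ring
  have h3 : Tendsto (fun x => (2 * kappa a)⁻¹ * (F a x / F a (1 - x))) (𝓝[>] 0) (𝓝 0) := by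
    have := ((tendsto_F_zero ha).div_atTop hlog).const_mul (2 * kappa a)⁻¹
    rwa [mul_zero] at this
  have h4 : Tendsto (fun x : ℝ => 1 - x) (𝓝[<] 1) (𝓝[>] 0) := by
    refine tendsto_nhdsWithin_iff.2 ⟨?_, ?_⟩
    · have : Tendsto (fun x : ℝ => 1 - x) (𝓝 1) (𝓝 (1 - 1)) :=
        (continuous_const.sub continuous_id).tendsto 1
      rw [sub_self] at this
      exact this.mono_left nhdsWithin_le_nhds
    · filter_upwards [self_mem_nhdsWithin] with x hx
      have hx : x < 1 := hx
      show 0 < 1 - x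
      linarith
  refine (h3.comp h4).congr fun x => ?_
  rw [Function.comp_apply, modulus_eq, sub_sub_cancel]

/-! ### Comparison of the moduli of two parameters. -/

lemma lt_of_strictAntiOn_of_tendsto_right {f : ℝ → ℝ} {l x : ℝ} (hf : StrictAntiOn f (Ioo 0 1))
    (hl : Tendsto f (𝓝[<] 1) (𝓝 l)) (hx : x ∈ Ioo (0 : ℝ) 1) : l < f x := by
  obtain ⟨y, hxy, hy⟩ := exists_between hx.2
  have hy' : y ∈ Ioo (0 : ℝ) 1 := ⟨hx.1.trans hxy, hy⟩
  refine (le_of_tendsto hl ?_).trans_lt (hf hx hy' hxy)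
  filter_upwards [Ioo_mem_nhdsLT hy] with z hz
  exact (hf hy' ⟨hy'.1.trans hz.1, hz.2⟩ hz.1).le

lemma lt_of_strictAntiOn_of_tendsto_left {f : ℝ → ℝ} {l x : ℝ} (hf : StrictAntiOn f (Ioo 0 1))
    (hl : Tendsto f (𝓝[>] 0) (𝓝 l)) (hx : x ∈ Ioo (0 : ℝ) 1) : f x < l := by
  obtain ⟨y, hy, hxy⟩ := exists_between hx.1
  have hy' : y ∈ Ioo (0 : ℝ) 1 := ⟨hy, hxy.trans hx.2⟩
  refine (hf hy' hx hxy).trans_le (ge_of_tendsto hl ?_)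
  filter_upwards [Ioo_mem_nhdsGT hy] with z hz
  exact (hf ⟨hz.1, hz.2.trans hy'.2⟩ hy' hz.2).le

lemma modulus_sub_strictAntiOn {a b : ℝ} (ha : 0 < a) (hab : a < b) (hb : b ≤ 1 / 2) :
    StrictAntiOn (fun x => modulus a x - modulus b x) (Ioo 0 1) := by
  have ha' : a ∈ Ioo (0 : ℝ) 1 := ⟨ha, by linarith⟩
  have hb' : b ∈ Ioo (0 : ℝ) 1 := ⟨by linarith, by linarith⟩
  have hd : ∀ x ∈ Ioo (0 : ℝ) 1, HasDerivAt (fun x => modulus a x - modulus b x) _ x :=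
    fun x hx => (hasDerivAt_modulus ha' hx).sub (hasDerivAt_modulus hb' hx)
  refine strictAntiOn_of_deriv_neg (convex_Ioo 0 1)
    (fun x hx => (hd x hx).continuousAt.continuousWithinAt) fun x hx => ?_
  rw [interior_Ioo] at hx
  rw [(hd x hx).deriv]
  have h1 := F_pos ha' (Ioo_subset_Ico_self hx)
  have h2 := F_lt_F ha hab hb hx
  have h3 := (one_sub_mem hx).1
  have h4 := hx.1
  have h5 : 1 / (2 * x * (1 - x) * F b x ^ 2) < 1 / (2 * x * (1 - x) * F a x ^ 2) := by
    gcongr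
  linarith

lemma modulus_lt_modulus {a b x : ℝ} (ha : 0 < a) (hab : a < b) (hb : b ≤ 1 / 2)
    (hx : x ∈ Ioo (0 : ℝ) 1) : modulus b x < modulus a x := by
  have h := lt_of_strictAntiOn_of_tendsto_right (modulus_sub_strictAntiOn ha hab hb)
    ((tendsto_modulus_one ⟨ha, by linarith⟩).sub (tendsto_modulus_one ⟨by linarith, by linarith⟩)) hx
  simp only [sub_self] at h
  linarith

/-- The logarithms cancel at 0, so the decreasing difference of moduli stays below its limit
(R(a)-R(b))/2 there. -/
lemma modulus_sub_R_lt {a b x : ℝ} (ha : 0 < a) (hab : a < b) (hb : b ≤ 1 / 2)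
    (hx : x ∈ Ioo (0 : ℝ) 1) : modulus a x - R a / 2 < modulus b x - R b / 2 := by
  have hl := (tendsto_modulus_add_log ⟨ha, by linarith⟩).sub
    (tendsto_modulus_add_log (a := b) ⟨by linarith, by linarith⟩)
  have h := lt_of_strictAntiOn_of_tendsto_left (modulus_sub_strictAntiOn ha hab hb)
    (hl.congr fun x => by ring) hx
  linarith

/-! ### The cubic transformation -/

lemma one_third_mem : (1 / 3 : ℝ) ∈ Ioo (0 : ℝ) 1 := ⟨by norm_num, by norm_num⟩

/-- The cube of the cubic transformation `x ↦ (9 x (1 + x + x²))^(1/3) / (1 + 2 x)`. -/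
noncomputable def cubicMap (x : ℝ) : ℝ := 1 - ((1 - x) / (1 + 2 * x)) ^ 3

lemma cubicMap_zero : cubicMap 0 = 0 := by norm_num [cubicMap]

lemma cubicMap_eq {x : ℝ} (hx : 0 ≤ x) :
    cubicMap x = 9 * x * (1 + x + x ^ 2) / (1 + 2 * x) ^ 3 := by
  have : 1 + 2 * x ≠ 0 := by positivity
  rw [cubicMap]
  field_simp
  ring

lemma div_mem {x : ℝ} (hx : x ∈ Ioo (0 : ℝ) 1) : (1 - x) / (1 + 2 * x) ∈ Ioo (0 : ℝ) 1 := by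
  have h0 := hx.1
  have h1 := (one_sub_mem hx).1
  refine ⟨by positivity, ?_⟩
  rw [div_lt_one (by positivity)]
  linarith

lemma pow_three_mem {x : ℝ} (hx : x ∈ Ioo (0 : ℝ) 1) : x ^ 3 ∈ Ioo (0 : ℝ) 1 :=
  ⟨pow_pos hx.1 3, pow_lt_one₀ hx.1.le hx.2 three_ne_zero⟩

lemma cubicMap_mem {x : ℝ} (hx : x ∈ Ioo (0 : ℝ) 1) : cubicMap x ∈ Ioo (0 : ℝ) 1 :=
  one_sub_mem (pow_three_mem (div_mem hx))

lemma hasDerivAt_cubicMap {x : ℝ} (hx : 0 ≤ x) :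
    HasDerivAt cubicMap (9 * (1 - x) ^ 2 / (1 + 2 * x) ^ 4) x := by
  have hne : 1 + 2 * x ≠ 0 := by positivity
  have h1 : HasDerivAt (fun x : ℝ => 1 - x) (-1) x := (hasDerivAt_id x).const_sub 1
  have h2 : HasDerivAt (fun x : ℝ => 1 + 2 * x) (2 * 1) x :=
    ((hasDerivAt_id x).const_mul 2).const_add 1
  refine (((h1.div h2 hne).pow 3).const_sub 1).congr_deriv ?_
  simp only [Pi.div_apply]
  push_cast
  field_simp
  ring

lemma hasDerivAt_comp_pow_three {f : ℝ → ℝ} {f' x : ℝ} (hf : HasDerivAt f f' (x ^ 3)) :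
    HasDerivAt (fun x => f (x ^ 3)) (f' * (3 * x ^ 2)) x := by
  have h := hasDerivAt_pow 3 x
  exact HasDerivAt.comp (h₂ := f) x hf (by simpa using h)

lemma hasDerivAt_comp_cubicMap {f : ℝ → ℝ} {f' x : ℝ} (hx : 0 ≤ x)
    (hf : HasDerivAt f f' (cubicMap x)) :
    HasDerivAt (fun x => f (cubicMap x)) (f' * (9 * (1 - x) ^ 2 / (1 + 2 * x) ^ 4)) x :=
  HasDerivAt.comp (h₂ := f) x hf (hasDerivAt_cubicMap hx)

lemma tendsto_nhdsGT_zero_of_hasDerivAt {f : ℝ → ℝ} {f' : ℝ} (hf : HasDerivAt f f' 0) :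
    Tendsto f (𝓝[>] 0) (𝓝 (f 0)) :=
  hf.continuousAt.tendsto.mono_left nhdsWithin_le_nhds

lemma eq_of_hasDerivAt_zero_of_tendsto {f : ℝ → ℝ} {l x : ℝ}
    (hf : ∀ x ∈ Ioo (0 : ℝ) 1, HasDerivAt f 0 x) (hl : Tendsto f (𝓝[>] 0) (𝓝 l))
    (hx : x ∈ Ioo (0 : ℝ) 1) : f x = l := by
  refine tendsto_nhds_unique (tendsto_const_nhds.congr' ?_) hl
  filter_upwards [Ioo_mem_nhdsGT (show (0 : ℝ) < 1 by norm_num)] with y hy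
  exact isOpen_Ioo.is_const_of_deriv_eq_zero isPreconnected_Ioo
    (fun z hz => (hf z hz).differentiableAt.differentiableWithinAt)
    (fun z hz => (hf z hz).deriv) hx hy

lemma flux_cubicMap (a : ℝ) {x : ℝ} (hx : 0 ≤ x) :
    flux a (cubicMap x) = 9 * x * (1 + x + x ^ 2) * (1 - x) ^ 3 / (1 + 2 * x) ^ 6 *
      dF a (cubicMap x) := by
  have h : 1 - cubicMap x = (1 - x) ^ 3 / (1 + 2 * x) ^ 3 := by
    rw [cubicMap, sub_sub_cancel, div_pow]
  rw [flux, h]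
  nth_rewrite 1 [cubicMap_eq hx]
  rw [div_mul_div_comm, ← pow_add]

/-- The Wronskian of the two sides of the cubic transformation formula vanishes. -/
lemma cubic_wronskian {x : ℝ} (hx : x ∈ Ioo (0 : ℝ) 1) :
    flux (1 / 3) (cubicMap x) * ((1 + 2 * x) * F (1 / 3) (x ^ 3)) -
      F (1 / 3) (cubicMap x) * (2 * x * (1 - x ^ 3) / (1 + 2 * x) ^ 2 * F (1 / 3) (x ^ 3) +
        3 * flux (1 / 3) (x ^ 3) / (1 + 2 * x)) = 0 := by
  have hd : ∀ {y : ℝ}, 0 ≤ y → |cubicMap y| < 1 → |y ^ 3| < 1 →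
      HasDerivAt (fun x => flux (1 / 3) (cubicMap x) * ((1 + 2 * x) * F (1 / 3) (x ^ 3)) -
          F (1 / 3) (cubicMap x) * (2 * x * (1 - x ^ 3) / (1 + 2 * x) ^ 2 * F (1 / 3) (x ^ 3) +
            3 * flux (1 / 3) (x ^ 3) / (1 + 2 * x))) _ y :=
    fun {y} hy hg h3 =>
    have hlin : HasDerivAt (fun x : ℝ => 1 + 2 * x) (2 * 1) y :=
      ((hasDerivAt_id y).const_mul 2).const_add 1
    have hrat : HasDerivAt (fun x : ℝ => 2 * x * (1 - x ^ 3) / (1 + 2 * x) ^ 2) _ y :=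
      ((((hasDerivAt_id y).const_mul 2).mul ((hasDerivAt_pow 3 y).const_sub 1)).div
        (hlin.pow 2) (by positivity))
    have F3 := hasDerivAt_comp_pow_three (hasDerivAt_F one_third_mem h3)
    (((hasDerivAt_comp_cubicMap hy (hasDerivAt_flux one_third_mem hg)).mul (hlin.mul F3)).sub
      ((hasDerivAt_comp_cubicMap hy (hasDerivAt_F one_third_mem hg)).mul
        ((hrat.mul F3).add (((hasDerivAt_comp_pow_three
          (hasDerivAt_flux one_third_mem h3)).const_mul 3).div hlin (by positivity)))))
  refine eq_of_hasDerivAt_zero_of_tendsto (f := fun x => flux (1 / 3) (cubicMap x) * ((1 + 2 * x) * F (1 / 3) (x ^ 3)) -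
      F (1 / 3) (cubicMap x) * (2 * x * (1 - x ^ 3) / (1 + 2 * x) ^ 2 * F (1 / 3) (x ^ 3) +
        3 * flux (1 / 3) (x ^ 3) / (1 + 2 * x)))
    (fun y hy => ?_) ?_ hx
  · refine (hd hy.1.le (abs_lt_one_of_mem (cubicMap_mem hy))
      (abs_lt_one_of_mem (pow_three_mem hy))).congr_deriv ?_
    have hne : 1 + 2 * y ≠ 0 := by have := hy.1; positivity
    simp only [Pi.mul_apply, id]
    rw [flux_cubicMap _ hy.1.le, flux]
    generalize F (1 / 3) (cubicMap y) = A
    generalize dF (1 / 3) (cubicMap y) = A'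
    generalize F (1 / 3) (y ^ 3) = B
    generalize dF (1 / 3) (y ^ 3) = B'
    obtain ⟨D, hD⟩ : ∃ D, D = 1 + 2 * y := ⟨_, rfl⟩
    rw [← hD] at hne ⊢
    push_cast
    field_simp
    rw [hD]
    ring
  · have h := tendsto_nhdsGT_zero_of_hasDerivAt
      (hd le_rfl (by simp [cubicMap_zero]) (by norm_num))
    simpa [cubicMap_zero, flux] using h

/-- The cubic transformation formula. -/
lemma F_cubicMap {x : ℝ} (hx : x ∈ Ioo (0 : ℝ) 1) :
    F (1 / 3) (cubicMap x) = (1 + 2 * x) * F (1 / 3) (x ^ 3) := by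
  have hV : ∀ {y : ℝ}, y ∈ Ico (0 : ℝ) 1 → (1 + 2 * y) * F (1 / 3) (y ^ 3) ≠ 0 := fun {y} hy =>
    have h0 := hy.1
    have := F_pos one_third_mem (x := y ^ 3) ⟨by positivity, pow_lt_one₀ h0 hy.2 three_ne_zero⟩
    by positivity
  have hd : ∀ {y : ℝ}, y ∈ Ico (0 : ℝ) 1 → |cubicMap y| < 1 → |y ^ 3| < 1 →
      HasDerivAt (fun x => F (1 / 3) (cubicMap x) / ((1 + 2 * x) * F (1 / 3) (x ^ 3))) _ y :=
    fun {y} hy hg h3 =>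
    have hlin : HasDerivAt (fun x : ℝ => 1 + 2 * x) (2 * 1) y :=
      ((hasDerivAt_id y).const_mul 2).const_add 1
    (hasDerivAt_comp_cubicMap hy.1 (hasDerivAt_F one_third_mem hg)).div
      (hlin.mul (hasDerivAt_comp_pow_three (hasDerivAt_F one_third_mem h3))) (hV hy)
  -- The quotient is constant because the Wronskian vanishes, and it equals 1 at 0.
  have h : F (1 / 3) (cubicMap x) / ((1 + 2 * x) * F (1 / 3) (x ^ 3)) = 1 := by
    refine eq_of_hasDerivAt_zero_of_tendsto
      (f := fun x => F (1 / 3) (cubicMap x) / ((1 + 2 * x) * F (1 / 3) (x ^ 3)))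
      (fun y hy => ?_) ?_ hx
    · refine (hd (Ioo_subset_Ico_self hy) (abs_lt_one_of_mem (cubicMap_mem hy))
        (abs_lt_one_of_mem (pow_three_mem hy))).congr_deriv ?_
      have hw := cubic_wronskian hy
      have hne : 1 + 2 * y ≠ 0 := by have := hy.1; positivity
      have hy0 := hy.1.ne'
      have hy3 := (one_sub_mem (pow_three_mem hy)).1.ne'
      refine div_eq_zero_iff.2 (Or.inl ?_)
      -- The weight p is y(1-y³)/(1+2y)²; this factor and (1+2y)² below convert G'H - GH' into
      -- `cubic_wronskian`.
      refine mul_left_cancel₀ (mul_ne_zero hy0 hy3) ?_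
      rw [flux_cubicMap _ hy.1.le, flux] at hw
      generalize F (1 / 3) (cubicMap y) = A at hw ⊢
      generalize dF (1 / 3) (cubicMap y) = A' at hw ⊢
      generalize F (1 / 3) (y ^ 3) = B at hw ⊢
      generalize dF (1 / 3) (y ^ 3) = B' at hw ⊢
      rw [mul_zero]
      refine Eq.trans ?_ ((congrArg (fun z => (1 + 2 * y) ^ 2 * z) hw).trans (mul_zero _))
      obtain ⟨D, hD⟩ : ∃ D, D = 1 + 2 * y := ⟨_, rfl⟩
      rw [← hD] at hne ⊢
      field_simp
      ring
    · have h := tendsto_nhdsGT_zero_of_hasDerivAt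
        (hd ⟨le_rfl, one_pos⟩ (by simp [cubicMap_zero]) (by norm_num))
      simpa [cubicMap_zero, F_zero] using h
  rwa [div_eq_one_iff_eq (hV (Ioo_subset_Ico_self hx))] at h

/-- Apply `F_cubicMap` at u = (1-x)/(1+2x): by the involution, g(u) = 1 - x³ and u³ = 1 - g(x). -/
lemma F_one_sub_pow_three {x : ℝ} (hx : x ∈ Ioo (0 : ℝ) 1) :
    F (1 / 3) (1 - x ^ 3) = 3 / (1 + 2 * x) * F (1 / 3) (1 - cubicMap x) := by
  have h := F_cubicMap (div_mem hx)
  have hne : 1 + 2 * x ≠ 0 := by have := hx.1; positivity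
  have e2 : 1 + 2 * ((1 - x) / (1 + 2 * x)) = 3 / (1 + 2 * x) := by field_simp; ring
  have e3 : 1 - (1 - x) / (1 + 2 * x) = 3 * x / (1 + 2 * x) := by
    rw [eq_div_iff hne, sub_mul, div_mul_cancel₀ _ hne]
    ring
  have e1 : cubicMap ((1 - x) / (1 + 2 * x)) = 1 - x ^ 3 := by
    rw [cubicMap, e2, e3, div_div_div_cancel_right₀ hne, mul_div_cancel_left₀ _ three_ne_zero]
  rw [e1, e2] at h
  rw [h, cubicMap, sub_sub_cancel]

lemma modulus_cubicMap {x : ℝ} (hx : x ∈ Ioo (0 : ℝ) 1) :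
    modulus (1 / 3) (cubicMap x) = modulus (1 / 3) (x ^ 3) / 3 := by
  have hne : 1 + 2 * x ≠ 0 := by have := hx.1; positivity
  rw [modulus_eq, modulus_eq, F_cubicMap hx, F_one_sub_pow_three hx]
  have := (F_pos one_third_mem (Ioo_subset_Ico_self (pow_three_mem hx))).ne'
  field_simp

/-- Complementation inverts the modulus up to a constant, turning division by 3 into multiplication
by 3. -/
lemma modulus_one_sub (a x : ℝ) :
    modulus a (1 - x) = ((2 * kappa a)⁻¹) ^ 2 / modulus a x := by
  rw [modulus_eq, modulus_eq, sub_sub_cancel]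
  by_cases hk : kappa a = 0
  · simp [hk]
  by_cases h1 : F a x = 0
  · simp [h1]
  by_cases h2 : F a (1 - x) = 0
  · simp [h2]
  field_simp

/-- `R (1/3) = log 27`. -/
lemma R_one_third : R (1 / 3) = Real.log 27 := by
  have hlim := tendsto_modulus_add_log one_third_mem
  have hc : ∀ {f : ℝ → ℝ} {f' : ℝ}, HasDerivAt f f' 0 → f 0 = 0 →
      (∀ x ∈ Ioo (0 : ℝ) 1, 0 < f x) → Tendsto f (𝓝[>] 0) (𝓝[>] 0) := by
    intro f f' hf h0 hpos
    refine tendsto_nhdsWithin_iff.2 ⟨?_, ?_⟩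
    · have := tendsto_nhdsGT_zero_of_hasDerivAt hf
      rwa [h0] at this
    · filter_upwards [Ioo_mem_nhdsGT (show (0 : ℝ) < 1 by norm_num)] with x hx
      exact hpos x hx
  have h1 := hlim.comp (hc (hasDerivAt_cubicMap le_rfl) cubicMap_zero
    fun x hx => (cubicMap_mem hx).1)
  have h2 := hlim.comp (hc (hasDerivAt_pow 3 (0 : ℝ)) (by norm_num)
    fun x hx => (pow_three_mem hx).1)
  have h3 : Tendsto (fun x : ℝ => Real.log (9 * (1 + x + x ^ 2) / (1 + 2 * x) ^ 3)) (𝓝[>] 0)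
      (𝓝 (Real.log 9)) := by
    have : ContinuousAt (fun x : ℝ => Real.log (9 * (1 + x + x ^ 2) / (1 + 2 * x) ^ 3)) 0 := by
      refine ContinuousAt.log (ContinuousAt.div (by fun_prop) (by fun_prop) (by norm_num))
        (by norm_num)
    have h := this.tendsto.mono_left (nhdsWithin_le_nhds (s := Ioi 0))
    simpa using h
  have h4 := (h2.div_const 3).add (h3.const_mul (1 / 2))
  -- Matching the asymptotics of the two sides of `modulus_cubicMap` at 0 gives R/2 = R/6 + ½ log 9.
  have h5 := tendsto_nhds_unique h1 (h4.congr' ?_)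
  · have e9 : Real.log 9 = 2 * Real.log 3 := by
      rw [show (9 : ℝ) = 3 ^ 2 by norm_num, Real.log_pow]; norm_num
    have e27 : Real.log 27 = 3 * Real.log 3 := by
      rw [show (27 : ℝ) = 3 ^ 3 by norm_num, Real.log_pow]; norm_num
    rw [e27]
    rw [e9] at h5
    linarith
  · filter_upwards [Ioo_mem_nhdsGT (show (0 : ℝ) < 1 by norm_num)] with x hx
    have hx0 := hx.1
    simp only [Function.comp_apply]
    have e : cubicMap x = x * (9 * (1 + x + x ^ 2) / (1 + 2 * x) ^ 3) := by
      rw [cubicMap_eq hx0.le]; ring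
    have e' : Real.log (cubicMap x) =
        Real.log x + Real.log (9 * (1 + x + x ^ 2) / (1 + 2 * x) ^ 3) := by
      rw [e, Real.log_mul hx0.ne' (by positivity)]
    rw [modulus_cubicMap hx, e', Real.log_pow]
    push_cast
    ring

/-! ### The iteration -/

lemma rpow_one_third_pow_three {x : ℝ} (hx : 0 ≤ x) : (x ^ (1 / 3 : ℝ)) ^ 3 = x := by
  rw [← Real.rpow_natCast, ← Real.rpow_mul hx]
  norm_num

lemma rStar_pow_three {r : ℝ} (hr : r ∈ Ioo (0 : ℝ) 1) : rStar r ^ 3 = 1 - r ^ 3 :=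
  rpow_one_third_pow_three (one_sub_mem (pow_three_mem hr)).1.le

lemma mem_of_pow_three_mem {x : ℝ} (hx : 0 ≤ x) (h : x ^ 3 ∈ Ioo (0 : ℝ) 1) :
    x ∈ Ioo (0 : ℝ) 1 := by
  refine ⟨hx.lt_of_ne fun h0 => ?_, ?_⟩
  · rw [← h0] at h
    norm_num at h
  · by_contra! h1
    exact absurd h.2 (not_lt.2 (one_le_pow₀ h1))

lemma rSeq_succ_pow_three {r : ℝ} {n : ℕ} (hn : rSeq r n ∈ Ioo (0 : ℝ) 1) :
    rSeq r (n + 1) ^ 3 = cubicMap (rSeq r n) := by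
  have h := hn.1
  rw [rSeq, div_pow, rpow_one_third_pow_three (by positivity), cubicMap_eq h.le]

lemma rSeq_mem {r : ℝ} (hr : r ∈ Ioo (0 : ℝ) 1) (n : ℕ) : rSeq r n ∈ Ioo (0 : ℝ) 1 := by
  induction n with
  | zero =>
    refine mem_of_pow_three_mem (Real.rpow_nonneg (one_sub_mem (pow_three_mem hr)).1.le _) ?_
    rw [rSeq, rStar_pow_three hr]
    exact one_sub_mem (pow_three_mem hr)
  | succ n ih =>
    refine mem_of_pow_three_mem ?_ ?_
    · have := ih.1
      rw [rSeq]
      positivity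
    · rw [rSeq_succ_pow_three ih]
      exact cubicMap_mem ih

lemma modulus_rSeq_succ {r : ℝ} (hr : r ∈ Ioo (0 : ℝ) 1) (n : ℕ) :
    modulus (1 / 3) (rSeq r (n + 1) ^ 3) = modulus (1 / 3) (rSeq r n ^ 3) / 3 := by
  rw [rSeq_succ_pow_three (rSeq_mem hr n), modulus_cubicMap (rSeq_mem hr n)]

lemma modulus_rSeq {r : ℝ} (hr : r ∈ Ioo (0 : ℝ) 1) (n : ℕ) :
    modulus (1 / 3) (rSeq r n ^ 3) = modulus (1 / 3) (rStar r ^ 3) / 3 ^ n := by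
  induction n with
  | zero => rw [rSeq, pow_zero, div_one]
  | succ n ih => rw [modulus_rSeq_succ hr, ih, pow_succ (3 : ℝ), div_div]

lemma rpow_three_halves_sq {x : ℝ} (hx : 0 ≤ x) : (x ^ (3 / 2 : ℝ)) ^ 2 = x ^ 3 := by
  rw [← Real.rpow_natCast, ← Real.rpow_mul hx, ← Real.rpow_natCast]
  norm_num

lemma rpow_three_halves_mem {x : ℝ} (hx : x ∈ Ioo (0 : ℝ) 1) :
    x ^ (3 / 2 : ℝ) ∈ Ioo (0 : ℝ) 1 :=
  ⟨Real.rpow_pos_of_pos hx.1 _, Real.rpow_lt_one hx.1.le hx.2 (by norm_num)⟩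

lemma mu_injOn {a : ℝ} (ha : a ∈ Ioo (0 : ℝ) 1) : InjOn (mu a) (Ioo 0 1) := by
  intro x hx y hy h
  have hsq : ∀ {z : ℝ}, z ∈ Ioo (0 : ℝ) 1 → z ^ 2 ∈ Ioo (0 : ℝ) 1 := fun hz =>
    ⟨pow_pos hz.1 2, pow_lt_one₀ hz.1.le hz.2 two_ne_zero⟩
  rw [mu_eq_modulus, mu_eq_modulus] at h
  have := (modulus_strictAntiOn ha).injOn (hsq hx) (hsq hy) h
  exact (pow_left_inj₀ hx.1.le hy.1.le two_ne_zero).1 this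

/-- The candidate t itself witnesses that the inverse is taken at an attained value, so injectivity
of μ_a suffices. -/
lemma phiStar_eq {K a s t : ℝ} (ha : a ∈ Ioo (0 : ℝ) 1) (hs : 0 ≤ s)
    (ht : t ∈ Ioo (0 : ℝ) 1) (h : modulus a (t ^ 3) = modulus a (s ^ 3) / K) :
    phiStar K a s = t := by
  have hmem := rpow_three_halves_mem ht
  have hmu : mu a (t ^ (3 / 2 : ℝ)) = mu a (s ^ (3 / 2 : ℝ)) / K := by
    rw [mu_eq_modulus, mu_eq_modulus, rpow_three_halves_sq ht.1.le, rpow_three_halves_sq hs, h]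
  have hex : ∃ u ∈ Ioo (0 : ℝ) 1, mu a u = mu a (s ^ (3 / 2 : ℝ)) / K := ⟨_, hmem, hmu⟩
  have hphi : phi K a (s ^ (3 / 2 : ℝ)) = t ^ (3 / 2 : ℝ) :=
    mu_injOn ha (Function.invFunOn_mem hex) hmem ((Function.invFunOn_eq hex).trans hmu.symm)
  rw [phiStar, hphi, ← Real.rpow_mul ht.1.le]
  norm_num

/-! ### Telescoping along the complementary sequence. -/

/-- The quantity `(1 + 2 r_n) (1 + r_n + r_n²)`. -/
noncomputable def base (r : ℝ) (n : ℕ) : ℝ :=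
  (1 + 2 * rSeq r n) * (1 + rSeq r n + rSeq r n ^ 2)

lemma one_le_base {r : ℝ} (hr : r ∈ Ioo (0 : ℝ) 1) (n : ℕ) : 1 ≤ base r n := by
  have h := (rSeq_mem hr n).1
  rw [base]
  nlinarith [pow_pos h 2, pow_pos h 3]

lemma logTerm_eq (r : ℝ) (n : ℕ) : logTerm r n = ((3 : ℝ) ^ n)⁻¹ * Real.log (base r n) := rfl

lemma factor_eq_exp {r : ℝ} (hr : r ∈ Ioo (0 : ℝ) 1) (n : ℕ) :
    factor r n = Real.exp (1 / 2 * logTerm r n) := by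
  have h : factor r n = base r n ^ (((3 : ℝ) ^ n)⁻¹ / 2) := rfl
  rw [h, Real.rpow_def_of_pos (one_pos.trans_le (one_le_base hr n)), logTerm_eq]
  congr 1
  ring

/-- The complementary quantity `1 - r_n ^ 3`. -/
noncomputable def compl (r : ℝ) (n : ℕ) : ℝ := 1 - rSeq r n ^ 3

lemma compl_mem {r : ℝ} (hr : r ∈ Ioo (0 : ℝ) 1) (n : ℕ) : compl r n ∈ Ioo (0 : ℝ) 1 :=
  one_sub_mem (pow_three_mem (rSeq_mem hr n))

lemma compl_zero {r : ℝ} (hr : r ∈ Ioo (0 : ℝ) 1) : compl r 0 = r ^ 3 := by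
  rw [compl, rSeq, rStar_pow_three hr, sub_sub_cancel]

/-- Factoring 1 - r_n³ shows (1-r_n)/(1+2r_n) = `compl r n / base r n`; this is where the factors of
the product come from. -/
lemma compl_succ {r : ℝ} (hr : r ∈ Ioo (0 : ℝ) 1) (n : ℕ) :
    compl r (n + 1) = (compl r n / base r n) ^ 3 := by
  have h := (rSeq_mem hr n).1
  have h1 : 1 + 2 * rSeq r n ≠ 0 := by positivity
  have h2 : 1 + rSeq r n + rSeq r n ^ 2 ≠ 0 := by positivity
  have h3 : compl r n = (1 - rSeq r n) * (1 + rSeq r n + rSeq r n ^ 2) := by rw [compl]; ring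
  rw [compl, rSeq_succ_pow_three (rSeq_mem hr n), cubicMap, sub_sub_cancel, h3, base,
    mul_div_mul_right _ _ h2]

lemma modulus_compl_succ {r : ℝ} (hr : r ∈ Ioo (0 : ℝ) 1) (n : ℕ) :
    modulus (1 / 3) (compl r (n + 1)) = 3 * modulus (1 / 3) (compl r n) := by
  rw [compl, compl, modulus_one_sub, modulus_one_sub, modulus_rSeq_succ hr]
  have := (modulus_pos one_third_mem (pow_three_mem (rSeq_mem hr n))).ne'
  field_simp

lemma compl_le {r : ℝ} (hr : r ∈ Ioo (0 : ℝ) 1) (n : ℕ) : compl r n ≤ (r ^ 3) ^ (n + 1) := by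
  have h3 := pow_three_mem hr
  induction n with
  | zero => rw [compl_zero hr, zero_add, pow_one]
  | succ n ih =>
    have hc := compl_mem hr n
    have hle : compl r n ≤ r ^ 3 :=
      ih.trans (pow_le_of_le_one h3.1.le h3.2.le n.succ_ne_zero)
    have hd : compl r n / base r n ≤ compl r n := div_le_self hc.1.le (one_le_base hr n)
    have hd0 : 0 ≤ compl r n / base r n :=
      div_nonneg hc.1.le (one_pos.le.trans (one_le_base hr n))
    calc compl r (n + 1) = (compl r n / base r n) ^ 3 := compl_succ hr n
      _ ≤ compl r n ^ 3 := pow_le_pow_left₀ hd0 hd 3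
      _ ≤ compl r n ^ 2 := pow_le_pow_of_le_one hc.1.le hc.2.le (by norm_num)
      _ = compl r n * compl r n := sq _
      _ ≤ (r ^ 3) ^ (n + 1) * r ^ 3 := mul_le_mul ih hle hc.1.le (by have := h3.1; positivity)
      _ = _ := (pow_succ _ _).symm

lemma tendsto_compl {r : ℝ} (hr : r ∈ Ioo (0 : ℝ) 1) :
    Tendsto (compl r) atTop (𝓝[>] 0) := by
  have h3 := pow_three_mem hr
  refine tendsto_nhdsWithin_iff.2 ⟨?_, .of_forall fun n => (compl_mem hr n).1⟩
  exact squeeze_zero (fun n => (compl_mem hr n).1.le) (compl_le hr)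
    ((tendsto_add_atTop_iff_nat 1).2 (tendsto_pow_atTop_nhds_zero_of_lt_one h3.1.le h3.2))

/-- The expansion of `μ + log` along the iteration. -/
lemma modulus_add_log_eq_sum {r : ℝ} (hr : r ∈ Ioo (0 : ℝ) 1) (n : ℕ) :
    modulus (1 / 3) (r ^ 3) + 1 / 2 * Real.log (r ^ 3) =
      1 / 2 * ∑ k ∈ Finset.range n, logTerm r k + ((3 : ℝ) ^ n)⁻¹ *
        (modulus (1 / 3) (compl r n) + 1 / 2 * Real.log (compl r n)) := by
  induction n with
  | zero => simp [compl_zero hr]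
  | succ n ih =>
    have hlog : Real.log (compl r (n + 1)) =
        3 * (Real.log (compl r n) - Real.log (base r n)) := by
      rw [compl_succ hr, Real.log_pow, Real.log_div (compl_mem hr n).1.ne'
        (one_pos.trans_le (one_le_base hr n)).ne']
      norm_num
    rw [ih, Finset.sum_range_succ, logTerm_eq r n, hlog, modulus_compl_succ hr, pow_succ]
    field_simp
    ring

lemma hasSum_logTerm {r : ℝ} (hr : r ∈ Ioo (0 : ℝ) 1) :
    HasSum (logTerm r) (2 * (muStar (1 / 3) r + 3 / 2 * Real.log r)) := by
  have hnn : ∀ n, 0 ≤ logTerm r n := fun n =>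
    mul_nonneg (by positivity) (Real.log_nonneg (one_le_base hr n))
  rw [hasSum_iff_tendsto_nat_of_nonneg hnn]
  -- The remainder bracket converges, so its weight 3^{-n} kills it.
  have h1 := (tendsto_modulus_add_log one_third_mem).comp (tendsto_compl hr)
  have h2 : Tendsto (fun n : ℕ => ((3 : ℝ) ^ n)⁻¹) atTop (𝓝 0) := by
    simpa using tendsto_pow_atTop_nhds_zero_of_lt_one (r := (3 : ℝ)⁻¹) (by norm_num) (by norm_num)
  have h3 := (h2.mul h1).const_sub (modulus (1 / 3) (r ^ 3) + 1 / 2 * Real.log (r ^ 3))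
    |>.const_mul 2
  have e : modulus (1 / 3) (r ^ 3) + 1 / 2 * Real.log (r ^ 3) =
      muStar (1 / 3) r + 3 / 2 * Real.log r := by
    rw [muStar_eq_modulus, Real.log_pow]
    push_cast
    ring
  rw [zero_mul, sub_zero, e] at h3
  refine h3.congr fun n => ?_
  rw [← e, modulus_add_log_eq_sum hr n, Function.comp_apply]
  ring

lemma hasProd_factor {r : ℝ} (hr : r ∈ Ioo (0 : ℝ) 1) :
    HasProd (factor r) (Real.exp (muStar (1 / 3) r + 3 / 2 * Real.log r)) := by
  have h := ((hasSum_logTerm hr).mul_left (1 / 2)).rexp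
  rw [← mul_assoc, one_div_mul_cancel two_ne_zero, one_mul] at h
  exact h.congr_fun fun n => factor_eq_exp hr n

/-- Since √27 = e^{R(1/3)/2}, the constant of the theorem is e^{(R(a)-R(1/3))/2}, and the
inequalities become comparisons of exponents. -/
lemma exp_R_div_sqrt (x y : ℝ) :
    1 / Real.sqrt 27 * Real.exp (x / 2) * Real.exp y = Real.exp (y + x / 2 - R (1 / 3) / 2) := by
  have h : Real.sqrt 27 = Real.exp (R (1 / 3) / 2) := by
    rw [R_one_third, ← Real.log_sqrt (by norm_num), Real.exp_log (by positivity)]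
  rw [h, one_div, ← Real.exp_neg, ← Real.exp_add, ← Real.exp_add]
  congr 1
  ring

end CubicModular

open CubicModular
theorem theorem1p2 (r : ℝ) (hr : r ∈ Ioo (0 : ℝ) 1) :
    -- the sequence `r_n` stays in `(0,1)` and is the orbit of `r^*` under `φ_3^*`
    (∀ n : ℕ, rSeq r n ∈ Ioo (0 : ℝ) 1) ∧
    (∀ n : ℕ, rSeq r (n + 1) = phiStar 3 (1 / 3) (rSeq r n)) ∧
    (∀ n : ℕ, rSeq r n = phiStar (3 ^ n) (1 / 3) (rStar r)) ∧
    -- the infinite product converges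
    Multipliable (factor r) ∧
    -- the bounds for `a ∈ (0, 1/3]`, with the equality cases
    (∀ a ∈ Ioc (0 : ℝ) (1 / 3),
      ∏' n, factor r n ≤ Real.exp (muStar a r + 3 / 2 * Real.log r) ∧
      Real.exp (muStar a r + 3 / 2 * Real.log r) ≤
        1 / Real.sqrt 27 * Real.exp (R a / 2) * ∏' n, factor r n ∧
      (∏' n, factor r n = Real.exp (muStar a r + 3 / 2 * Real.log r) ↔ a = 1 / 3) ∧
      (Real.exp (muStar a r + 3 / 2 * Real.log r) =
        1 / Real.sqrt 27 * Real.exp (R a / 2) * ∏' n, factor r n ↔ a = 1 / 3)) ∧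
    -- the reversed bounds for `a ∈ [1/3, 1/2]`, with the equality cases
    (∀ a ∈ Icc (1 / 3 : ℝ) (1 / 2),
      1 / Real.sqrt 27 * Real.exp (R a / 2) * ∏' n, factor r n ≤
        Real.exp (muStar a r + 3 / 2 * Real.log r) ∧
      Real.exp (muStar a r + 3 / 2 * Real.log r) ≤ ∏' n, factor r n ∧
      (1 / Real.sqrt 27 * Real.exp (R a / 2) * ∏' n, factor r n =
        Real.exp (muStar a r + 3 / 2 * Real.log r) ↔ a = 1 / 3) ∧
      (Real.exp (muStar a r + 3 / 2 * Real.log r) = ∏' n, factor r n ↔ a = 1 / 3)) ∧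
    -- the product and series formulas for `a = 1/3`
    muStar (1 / 3) r = mu (1 / 3) (r ^ (3 / 2 : ℝ)) ∧
    HasProd (factor r) (Real.exp (muStar (1 / 3) r + 3 / 2 * Real.log r)) ∧
    Summable (logTerm r) ∧
    muStar (1 / 3) r + 3 / 2 * Real.log r = 1 / 2 * ∑' n, logTerm r n := by
  have hprod := hasProd_factor hr
  have hsum := hasSum_logTerm hr
  have h0 := rSeq_mem hr 0
  refine ⟨rSeq_mem hr, fun n => ?_, fun n => ?_, hprod.multipliable, ?_, ?_, ?_, hprod,
    hsum.summable, ?_⟩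
  · exact (phiStar_eq one_third_mem (rSeq_mem hr n).1.le (rSeq_mem hr (n + 1))
      (modulus_rSeq_succ hr n)).symm
  · exact (phiStar_eq one_third_mem h0.1.le (rSeq_mem hr n) (modulus_rSeq hr n)).symm
  · rintro a ⟨ha0, ha⟩
    rw [hprod.tprod_eq, exp_R_div_sqrt, Real.exp_le_exp, Real.exp_le_exp, Real.exp_eq_exp,
      Real.exp_eq_exp]
    rcases ha.eq_or_lt with rfl | ha
    · simp
    · have h1 := modulus_lt_modulus ha0 ha (by norm_num) (pow_three_mem hr)
      have h2 := modulus_sub_R_lt ha0 ha (by norm_num) (pow_three_mem hr)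
      rw [← muStar_eq_modulus, ← muStar_eq_modulus] at h1 h2
      refine ⟨by linarith, by linarith, iff_of_false (fun h => ?_) ha.ne,
        iff_of_false (fun h => ?_) ha.ne⟩ <;> linarith
  · rintro a ⟨ha, ha2⟩
    rw [hprod.tprod_eq, exp_R_div_sqrt, Real.exp_le_exp, Real.exp_le_exp, Real.exp_eq_exp,
      Real.exp_eq_exp]
    rcases ha.eq_or_lt with rfl | ha
    · simp
    · have h1 := modulus_lt_modulus (by norm_num) ha ha2 (pow_three_mem hr)
      have h2 := modulus_sub_R_lt (by norm_num) ha ha2 (pow_three_mem hr)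
      rw [← muStar_eq_modulus, ← muStar_eq_modulus] at h1 h2
      refine ⟨by linarith, by linarith, iff_of_false (fun h => ?_) ha.ne',
        iff_of_false (fun h => ?_) ha.ne'⟩ <;> linarith
  · rw [muStar_eq_modulus, mu_eq_modulus, rpow_three_halves_sq hr.1.le]
  · rw [hsum.tsum_eq]
    ring
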